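/- Let $K$ be an infinite field. For a finite quiver $\Gamma$, compose paths in $K\Gamma$ so that $qp$ means "$q$ after $p$", and let $\Lambda=K\Gamma/I$ with $I$ an admissible ideal. A module is uniserial if its submodules form a chain. A path $p$ of length $l$ is a *mast* if $pU\neq 0$ for some uniserial left $\Lambda$-module $U$ of composition length $l+1$. Condition (N) says: whenever $\alpha:e\to e'$ is an arrow and $p:e\to e'$ is a mast of positive length, then $p=c'\alpha$ or $p=\alpha c$ for some (possibly trivial) oriented cycle $c'$ at $e'$, respectively $c$ at $e$. A *right subpath* of a path $p$ is a path $u$ with $p=u'u$ for some path $u'$. A *detour* on $p$ is a pair $(\alpha,u)$, where $u$ is a right subpath of $p$ and $\alpha$ an arrow such that $\alpha u$ is a path but not a right subpath of $p$, and such that the set $I(\alpha,u)$ of right subpaths of $p$ that are strictly longer than $u$ and end in the same vertex as $\alpha$ is nonempty. Take a variable $X_v(\alpha,u)$ for each detour $(\alpha,u)$ and each $v\in I(\alpha,u)$. Given a path starting where $p$ starts, substitute successively from the right: for a right subpath $u$ of $p$ and an arrow $\alpha$ with $\alpha u$ a path, leave $\alpha u$ unchanged if it is a right subpath of $p$, replace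 it by $\sum_{v\in I(\alpha,u)}X_v(\alpha,u)\,v$ if $(\alpha,u)$ is a detour, and by $0$ otherwise. This turns every $z\in K\Gamma e$, where $e$ is the starting vertex of $p$, into an expression $\sum_v \tau^z_v(X)\,v$, with $v$ running through the right subpaths of $p$ and $\tau^z_v$ polynomials over $K$. Let $V_p$ be the set of common zeros, with coordinates in $K$, of all $\tau^z_v$ with $z\in Ie$. For $k\in V_p$ let $\Phi_p(k)$ be the isomorphism type of the left $\Lambda$-module with one generator $x=ex$ and relations $\alpha u x=\sum_{v\in I(\alpha,u)}k_v(\alpha,u)\,vx$, for all right subpaths $u$ of $p$ and arrows $\alpha$ such that $\alpha u$ is a path but not a right subpath of $p$ (the empty sum being $0$). Now suppose that $\Gamma$ has no double arrows. Let $\mathbb S=(S(0),\dots,S(l))$ be a sequence of simple left $\Lambda$-modules such that there is a path $p$ of length $l$ passing, in this order, through the vertices corresponding to $S(0),\dots,S(l)$; this path is unique, and one writes $V_{\mathbb S}=V_p$, $\Phi_{\mathbb S}=\Phi_p$. A uniserial module has composition series $\mathbb S$ if its consecutive composition factors, from the top down, are $S(0),\dots,S(l)$. **Proposition 3.7.**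 Let $V\subseteq K^n$ be any affine algebraic variety, i.e. the set of common zeros of a set of polynomials in $K[X_1,\dots,X_n]$ (not necessarily irreducible). Then there exist a finite quiver $\Gamma$ without double arrows, an admissible ideal $I\subseteq K\Gamma$ such that $\Lambda=K\Gamma/I$ satisfies (N), and a sequence $\mathbb S$ of simple left $\Lambda$-modules as above, such that $V_{\mathbb S}\cong V$, that is, there are mutually inverse polynomial maps between $V_{\mathbb S}$ and $V$. Moreover, $\mathbb S$ can be chosen so that, at the same time, $\Phi_{\mathbb S}$ is a bijection from $V_{\mathbb S}$ onto the set of isomorphism types of uniserial left $\Lambda$-modules with composition series $\mathbb S$. -/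

import Mathlib

open CategoryTheory

universe u

namespace Uniserial

section PathAlgebra

/-- The path algebra `K Γ`: finitely supported functions on the set of all paths of `Γ` (the trivial
path at a vertex included).  A path is a triple (source, target, path between them).
`Quiver.Path.comp u v` is the path "first `u`, then `v`"; the product of the path algebra uses the
opposite order, `q * p` being "`q` after `p`". -/
def PathAlgebra (K : Type u) [Field K] (Γ : Type) [Quiver.{0} Γ] : Type u :=
  (Σ a b : Γ, Quiver.Path a b) →₀ K

variable {K : Type u} [Field K] {Γ : Type} [Quiver.{0} Γ]

noncomputable instance : AddCommGroup (PathAlgebra K Γ) :=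
  inferInstanceAs (AddCommGroup ((Σ a b : Γ, Quiver.Path a b) →₀ K))

noncomputable instance : Module K (PathAlgebra K Γ) :=
  inferInstanceAs (Module K ((Σ a b : Γ, Quiver.Path a b) →₀ K))

/-- The paths form a basis of the path algebra. -/
noncomputable def pathBasis (K : Type u) [Field K] (Γ : Type) [Quiver.{0} Γ] :
    Module.Basis (Σ a b : Γ, Quiver.Path a b) K (PathAlgebra K Γ) :=
  Module.Basis.ofRepr
    (LinearEquiv.refl K _ : PathAlgebra K Γ ≃ₗ[K] ((Σ a b : Γ, Quiver.Path a b) →₀ K))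

/-- A path as an element of the path algebra. -/
noncomputable def ofPath (K : Type u) [Field K] {Γ : Type} [Quiver.{0} Γ] {a b : Γ}
    (q : Quiver.Path a b) : PathAlgebra K Γ := pathBasis K Γ ⟨a, b, q⟩

/-- The coefficient of a path in an element of the path algebra. -/
noncomputable def coeff (z : PathAlgebra K Γ) {a b : Γ} (q : Quiver.Path a b) : K :=
  (pathBasis K Γ).repr z ⟨a, b, q⟩

/-- The vertex `a`, i.e. the trivial path at `a`, as an idempotent of the path algebra. -/
noncomputable def vertexIdem (K : Type u) [Field K] (a : Γ) : PathAlgebra K Γ :=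
  ofPath K (Quiver.Path.nil : Quiver.Path a a)

open scoped Classical in
/-- The product `q p` ("`q` after `p`") of two paths; zero if `p` does not end where `q` starts. -/
noncomputable def pathMul (K : Type u) [Field K] (q p : Σ a b : Γ, Quiver.Path a b) :
    PathAlgebra K Γ :=
  if h : p.2.1 = q.1 then ofPath K (p.2.2.comp (q.2.2.cast h.symm rfl)) else 0

/-- The multiplication of the path algebra, the bilinear extension of `pathMul`. -/
noncomputable def mulHom (K : Type u) [Field K] (Γ : Type) [Quiver.{0} Γ] :
    PathAlgebra K Γ →ₗ[K] PathAlgebra K Γ →ₗ[K] PathAlgebra K Γ :=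
  (pathBasis K Γ).constr K fun q => (pathBasis K Γ).constr K fun p => pathMul K q p

noncomputable instance : Mul (PathAlgebra K Γ) := ⟨fun x y => mulHom K Γ x y⟩

theorem mul_def (x y : PathAlgebra K Γ) : x * y = mulHom K Γ x y := rfl

theorem ofPath_mul_ofPath {a b c d : Γ} (q : Quiver.Path c d) (p : Quiver.Path a b) :
    ofPath K q * ofPath K p = pathMul K ⟨c, d, q⟩ ⟨a, b, p⟩ := by
  rw [mul_def, mulHom, ofPath, ofPath, Module.Basis.constr_basis, Module.Basis.constr_basis]

theorem ofPath_mul_ofPath_same {a b c : Γ} (q : Quiver.Path b c) (p : Quiver.Path a b) :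
    ofPath K q * ofPath K p = ofPath K (p.comp q) := by
  rw [ofPath_mul_ofPath, pathMul, dif_pos rfl]
  rfl

theorem ofPath_mul_ofPath_ne {a b c d : Γ} (q : Quiver.Path c d) (p : Quiver.Path a b)
    (h : b ≠ c) : ofPath K q * ofPath K p = 0 := by
  rw [ofPath_mul_ofPath, pathMul, dif_neg h]

/-- Linear maps out of the path algebra that agree on paths are equal. -/
theorem lhom_ext {M : Type*} [AddCommMonoid M] [Module K M] {f g : PathAlgebra K Γ →ₗ[K] M}
    (h : ∀ (a b : Γ) (q : Quiver.Path a b), f (ofPath K q) = g (ofPath K q)) : f = g := by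
  exact (pathBasis K Γ).ext fun x => h x.1 x.2.1 x.2.2

theorem mulHom_assoc (x y z : PathAlgebra K Γ) : x * y * z = x * (y * z) := by
  have key : (mulHom K Γ).compr₂ (mulHom K Γ) =
      ((LinearMap.llcomp K (PathAlgebra K Γ) (PathAlgebra K Γ) (PathAlgebra K Γ)).flip.comp
        (mulHom K Γ)).flip.comp (mulHom K Γ) := by
    refine lhom_ext fun a b q => lhom_ext fun c d r => lhom_ext fun e f s => ?_
    change ofPath K q * ofPath K r * ofPath K s = ofPath K q * (ofPath K r * ofPath K s)
    by_cases h₁ : d = a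
    · subst h₁
      by_cases h₂ : f = c
      · subst h₂
        simp only [ofPath_mul_ofPath_same, Quiver.Path.comp_assoc]
      · rw [ofPath_mul_ofPath_same, ofPath_mul_ofPath_ne _ _ h₂, ofPath_mul_ofPath_ne _ _ h₂,
          mul_def, map_zero]
    · rw [ofPath_mul_ofPath_ne _ _ h₁, mul_def, map_zero, LinearMap.zero_apply]
      by_cases h₂ : f = c
      · subst h₂
        rw [ofPath_mul_ofPath_same, ofPath_mul_ofPath_ne _ _ h₁]
      · rw [ofPath_mul_ofPath_ne _ _ h₂, mul_def, map_zero]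
  exact LinearMap.congr_fun (LinearMap.congr_fun (LinearMap.congr_fun key x) y) z

variable [Fintype Γ]

noncomputable instance : One (PathAlgebra K Γ) := ⟨∑ a : Γ, vertexIdem K a⟩

theorem one_def : (1 : PathAlgebra K Γ) = ∑ a : Γ, vertexIdem K a := rfl

theorem one_mul_aux (x : PathAlgebra K Γ) : 1 * x = x := by
  have key : mulHom K Γ 1 = LinearMap.id := by
    refine lhom_ext fun a b q => ?_
    have h₁ : vertexIdem K b * ofPath K q = ofPath K q := ofPath_mul_ofPath_same _ _
    have h₂ : ∀ c, c ≠ b → vertexIdem K c * ofPath K q = 0 :=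
      fun c hc => ofPath_mul_ofPath_ne _ _ hc.symm
    simp only [mul_def] at h₁ h₂
    rw [one_def, map_sum, LinearMap.sum_apply, Finset.sum_eq_single b (fun c _ hc => h₂ c hc)
      (by simp), h₁, LinearMap.id_apply]
  rw [mul_def, key, LinearMap.id_apply]

theorem mul_one_aux (x : PathAlgebra K Γ) : x * 1 = x := by
  have key : (mulHom K Γ).flip 1 = LinearMap.id := by
    refine lhom_ext fun a b q => ?_
    have h₁ : ofPath K q * vertexIdem K a = ofPath K q := by
      rw [vertexIdem, ofPath_mul_ofPath_same, Quiver.Path.nil_comp]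
    have h₂ : ∀ c, c ≠ a → ofPath K q * vertexIdem K c = 0 :=
      fun c hc => ofPath_mul_ofPath_ne _ _ hc
    simp only [mul_def] at h₁ h₂
    rw [LinearMap.flip_apply, one_def, map_sum, Finset.sum_eq_single a (fun c _ hc => h₂ c hc)
      (by simp), h₁, LinearMap.id_apply]
  rw [mul_def, ← LinearMap.flip_apply, key, LinearMap.id_apply]

noncomputable instance : Ring (PathAlgebra K Γ) :=
  { (inferInstance : AddCommGroup (PathAlgebra K Γ)) with
    mul := (· * ·)
    one := 1
    left_distrib := fun x y z => map_add (mulHom K Γ x) y z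
    right_distrib := fun x y z => LinearMap.map_add₂ (mulHom K Γ) x y z
    zero_mul := fun x => LinearMap.map_zero₂ (mulHom K Γ) x
    mul_zero := fun x => map_zero (mulHom K Γ x)
    mul_assoc := mulHom_assoc
    one_mul := one_mul_aux
    mul_one := mul_one_aux }

noncomputable instance : Algebra K (PathAlgebra K Γ) :=
  Algebra.ofModule (fun c x y => LinearMap.map_smul₂ (mulHom K Γ) c x y)
    (fun c x y => map_smul (mulHom K Γ x) c y)

/-- An ideal `I` of `K Γ` is admissible if it lies between the square and some power of the ideal
generated by the arrows: its elements involve only paths of length at least `2`, and it contains all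
sufficiently long paths. -/
def IsAdmissible (I : Ideal (PathAlgebra K Γ)) : Prop :=
  (∀ z ∈ I, ∀ (a b : Γ) (q : Quiver.Path a b),
    coeff z q ≠ 0 → 2 ≤ q.length) ∧
  ∃ N : ℕ, ∀ (a b : Γ) (q : Quiver.Path a b), N ≤ q.length → ofPath K q ∈ I

end PathAlgebra

section Modules

/-- A module is uniserial if its submodules form a chain. -/
def IsUniserial (R : Type u) [Ring R] (U : Type u) [AddCommGroup U] [Module R U] : Prop :=
  ∀ N N' : Submodule R U, N ≤ N' ∨ N' ≤ N

/-- `U` has a composition series with consecutive factors `S 0, …, S l`, from the top down. -/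
def HasCompositionFactors (R : Type u) [Ring R] (U : Type u) [AddCommGroup U] [Module R U]
    {l : ℕ} (S : Fin (l + 1) → ModuleCat.{u} R) : Prop :=
  ∃ F : Fin (l + 2) → Submodule R U, F 0 = ⊤ ∧ F (Fin.last (l + 1)) = ⊥ ∧
    ∀ i : Fin (l + 1), F i.succ ≤ F i.castSucc ∧
      Nonempty ((F i.castSucc ⧸ (F i.succ).submoduleOf (F i.castSucc)) ≃ₗ[R] S i)

/-- Isomorphism types of left `R`-modules. -/
abbrev IsoType (R : Type u) [Ring R] : Type (u + 1) :=
  Quotient (isIsomorphicSetoid (ModuleCat.{u} R))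

/-- The isomorphism types of uniserial left `R`-modules with composition series `S`. -/
def uniserialTypes (R : Type u) [Ring R] {l : ℕ} (S : Fin (l + 1) → ModuleCat.{u} R) :
    Set (IsoType R) :=
  {c | ∃ U : ModuleCat.{u} R, (Quotient.mk _ U : IsoType R) = c ∧ IsUniserial R U ∧
    HasCompositionFactors R U S}

variable {K : Type u} [Field K] {Γ : Type} [Quiver.{0} Γ] [Fintype Γ]
  (I : Ideal (PathAlgebra K Γ)) [I.IsTwoSided]

/-- The path `p` of length `l` is a mast of some uniserial left module `U` of length `l + 1` over
`K Γ / I`, i.e. `p U ≠ 0`. -/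
def IsMast {a b : Γ} (p : Quiver.Path a b) : Prop :=
  ∃ U : ModuleCat.{u} (PathAlgebra K Γ ⧸ I), IsUniserial (PathAlgebra K Γ ⧸ I) U ∧
    Module.length (PathAlgebra K Γ ⧸ I) U = p.length + 1 ∧
    ∃ x : U, Ideal.Quotient.mk I (ofPath K p) • x ≠ 0

/-- Condition (N): if `α : e ⟶ e'` is an arrow and `p : e → e'` a mast of positive length, then `p`
is `α` followed by an oriented cycle at `e'`, or an oriented cycle at `e` followed by `α`
(trivial cycles being allowed). -/
def ConditionN : Prop :=
  ∀ (e e' : Γ) (α : e ⟶ e') (p : Quiver.Path e e'), 0 < p.length → IsMast I p →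
    (∃ c' : Quiver.Path e' e', p = α.toPath.comp c') ∨ (∃ c : Quiver.Path e e, p = c.cons α)

/-- `S` is a simple left `K Γ / I`-module, and it corresponds to the vertex `e`: the idempotent `e`
does not annihilate it. -/
def IsSimpleAt (e : Γ) (S : ModuleCat.{u} (PathAlgebra K Γ ⧸ I)) : Prop :=
  IsSimpleModule (PathAlgebra K Γ ⧸ I) S ∧
    ∃ s : S, Ideal.Quotient.mk I (vertexIdem K e) • s ≠ 0

end Modules

section Variety

variable {Γ : Type} [Quiver.{0} Γ] {a b : Γ}

/-- `u` is a right subpath (that is, an initial segment) of `p`. -/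
def IsRightSubpath (p : Quiver.Path a b) {x : Γ} (u : Quiver.Path a x) : Prop :=
  ∃ w : Quiver.Path x b, u.comp w = p

/-- The right subpaths of `p` that end in the vertex `x`. -/
def RightSubpath (p : Quiver.Path a b) (x : Γ) : Type :=
  {u : Quiver.Path a x // IsRightSubpath p u}

/-- A right subpath of `p` with given end is determined by its length. -/
theorem RightSubpath.length_injective (p : Quiver.Path a b) (x : Γ) :
    Function.Injective fun u : RightSubpath p x => u.1.length := by
  rintro ⟨u, w, hw⟩ ⟨u', w', hw'⟩ h
  exact Subtype.ext ((Quiver.Path.comp_inj' h).1 (hw.trans hw'.symm)).1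

instance (p : Quiver.Path a b) (x : Γ) : Finite (RightSubpath p x) := by
  refine Finite.of_injective
    (fun u : RightSubpath p x => (⟨u.1.length, ?_⟩ : Fin (p.length + 1)))
    fun u v h => RightSubpath.length_injective p x (by simpa using h)
  obtain ⟨u, w, hw⟩ := u
  have := congrArg Quiver.Path.length hw
  rw [Quiver.Path.length_comp] at this
  change u.length < p.length + 1
  omega

noncomputable instance (p : Quiver.Path a b) (x : Γ) : Fintype (RightSubpath p x) :=
  Fintype.ofFinite _

/-- The triples `(α, u, v)` that index the variables `X_v(α, u)`: here `(α, u)` is a detour on `p`,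
that is, `u` is a right subpath of `p` and `α` is an arrow such that `α u` is a path but not a right
subpath of `p`, and `v` is a right subpath of `p`, strictly longer than `u`, ending in the same
vertex as `α`. -/
structure DetourVar (p : Quiver.Path a b) : Type where
  /-- the vertex where `α` starts -/
  x : Γ
  /-- the vertex where `α` ends -/
  y : Γ
  /-- the arrow -/
  α : x ⟶ y
  /-- the right subpath from which the detour departs -/
  u : RightSubpath p x
  /-- the longer right subpath -/
  v : RightSubpath p y
  not_right : ¬ IsRightSubpath p (u.1.cons α)
  longer : u.1.length < v.1.length

open scoped Classical in
/-- The coefficients of the substitution equations for `p`, where `c` supplies the values of the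
variables.  For a right subpath `u` of `p` and an arrow `α` with `α u` a path, `α u` is replaced by
`∑ v, substCoeff p c α u v • v`, the sum over the right subpaths `v` ending where `α` does.  Thus
`α u` stays put if it is a right subpath itself, it is replaced by `∑ c (α, u, v) • v`, with `v`
running through the right subpaths longer than `u`, if `(α, u)` is a detour, and by `0` otherwise. -/
noncomputable def substCoeff {A : Type*} [CommRing A] (p : Quiver.Path a b) (c : DetourVar p → A)
    {x y : Γ} (α : x ⟶ y) (u : RightSubpath p x) (v : RightSubpath p y) : A :=
  if h : IsRightSubpath p (u.1.cons α) then (if v.1 = u.1.cons α then 1 else 0)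
  else if h' : u.1.length < v.1.length then c ⟨x, y, α, u, v, h, h'⟩ else 0

open scoped Classical in
/-- The result of inserting the substitution equations from the right, successively, into the path
`q` starting where `p` starts: `q` becomes `∑ v, reduce p c q v • v`, the sum over the right
subpaths `v` of `p` ending where `q` does. -/
noncomputable def reduce {A : Type*} [CommRing A] (p : Quiver.Path a b) (c : DetourVar p → A) :
    {y : Γ} → Quiver.Path a y → RightSubpath p y → A
  | _, .nil => fun v => if v.1 = Quiver.Path.nil then 1 else 0
  | _, .cons q α => fun v => ∑ u, reduce p c q u * substCoeff p c α u v

variable {K : Type u} [Field K]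

/-- The polynomial `τ` with which the right subpath `v` of `p` occurs in the element `z` of the path
algebra after the substitution equations (in the variables `X_v(α, u)`) have been inserted.  Only the
paths in `z` starting where `p` does matter. -/
noncomputable def tau (p : Quiver.Path a b) (z : PathAlgebra K Γ) {y : Γ}
    (v : RightSubpath p y) : MvPolynomial (DetourVar p) K :=
  ∑ᶠ q : Quiver.Path a y,
    MvPolynomial.C (coeff z q) * reduce p MvPolynomial.X q v

variable [Fintype Γ]

/-- The variety `V_p`: the common zeros of all the polynomials obtained from relations in `I` by means
of the substitution equations for `p`. -/
def pathVariety (I : Ideal (PathAlgebra K Γ)) (p : Quiver.Path a b) : Set (DetourVar p → K) :=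
  {k | ∀ z ∈ I, ∀ (y : Γ) (v : RightSubpath p y), MvPolynomial.eval k (tau p z v) = 0}

/-- The left ideal of `Λ = K Γ / I` such that `Λ` modulo it is the left module with one generator `x`
(`x = e x` for the starting vertex `e` of `p`) subject to the equations
`α u x = ∑ v, k (α, u, v) • v x` for the detours `(α, u)` on `p`, and `α u x = 0` if `u` is a right
subpath, `α u` is a path and not a right subpath, and `(α, u)` is not a detour. -/
noncomputable def defIdeal (I : Ideal (PathAlgebra K Γ)) [I.IsTwoSided] (p : Quiver.Path a b)
    (k : DetourVar p → K) : Ideal (PathAlgebra K Γ ⧸ I) :=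
  Ideal.span
    ({1 - Ideal.Quotient.mk I (vertexIdem K a)} ∪
      {z | ∃ (x y : Γ) (α : x ⟶ y) (u : RightSubpath p x),
        z = Ideal.Quotient.mk I
          (ofPath K (u.1.cons α) - ∑ v, substCoeff p k α u v • ofPath K v.1)})

/-- The canonical map `Φ_p`, sending a point `k` of `V_p` to the isomorphism type of the uniserial
module with mast `p` that has a top element `x` with `α u x = ∑ v, k (α, u, v) • v x`. -/
noncomputable def Phi (I : Ideal (PathAlgebra K Γ)) [I.IsTwoSided] (p : Quiver.Path a b)
    (k : DetourVar p → K) : IsoType (PathAlgebra K Γ ⧸ I) :=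
  Quotient.mk _ (ModuleCat.of _ ((PathAlgebra K Γ ⧸ I) ⧸ defIdeal I p k))

end Variety

section AffineVarieties

variable {K : Type u} [Field K]

/-- Affine algebraic varieties (not necessarily irreducible): the sets of common zeros in affine
space of sets of polynomials. -/
def IsAffineVariety {σ : Type} (V : Set (σ → K)) : Prop :=
  ∃ F : Set (MvPolynomial σ K), V = {x | ∀ f ∈ F, MvPolynomial.eval x f = 0}

/-- Isomorphism of affine varieties: there are mutually inverse bijections between them that are
given by polynomials. -/
def VarietyIso {σ τ : Type} (V : Set (σ → K)) (W : Set (τ → K)) : Prop :=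
  ∃ (f : τ → MvPolynomial σ K) (g : σ → MvPolynomial τ K),
    (∀ x ∈ V, (fun j => MvPolynomial.eval x (f j)) ∈ W) ∧
    (∀ y ∈ W, (fun i => MvPolynomial.eval y (g i)) ∈ V) ∧
    (∀ x ∈ V, (fun i => MvPolynomial.eval (fun j => MvPolynomial.eval x (f j)) (g i)) = x) ∧
    (∀ y ∈ W, (fun j => MvPolynomial.eval (fun i => MvPolynomial.eval y (g i)) (f j)) = y)

end AffineVarieties

end Uniserial

/-! The quiver is a chain with vertices 0, …, 2N, an arrow from each vertex to the next and a loop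
at each odd vertex; the mast p takes every loop exactly once. Its only detours leave an odd vertex
before the loop, and each has a single longer right subpath to land on. So there is one variable per
loop, and a path from 0 to 2N skipping the loops of a set A is turned into the product of the
variables of A, times p (`LoopChain.act_skip`). Linear combinations of such paths impose arbitrary
squarefree equations (`LoopChain.exists_pathVariety_eq`). Every affine variety is isomorphic to a
squarefree one: copy each coordinate, identify the copies by linear equations, and spread powers
over the copies (`LoopChain.exists_varietyIso`).

Instead of generators, the ideal is given as `relIdeal`: all elements of the square of the arrow
ideal that annihilate the modules attached to a prescribed set W. It is two-sided and admissible,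
with W ⊆ V_p, almost by construction. Equality only needs the desired relations to lie in it, which
holds because they start at a source.

The bijectivity of Φ is general: it needs no double arrows and a path returning never to its
starting vertex (`Phi_bijOn`). Substitution is a representation on the span of the right subpaths; k
lies in V_p iff I annihilates its top element (`mem_pathVariety`). Arrows strictly lengthen leading
terms and continuation along p preserves leading coefficients, so submodules form a chain
(`ideal_chain`). Injectivity holds since the top element is unique up to scalars (`Phi_injOn`). For
surjectivity, uniseriality forces the arrows of p to carry each layer onto the next
(`arrow_notMem`), so the elements u x form a basis and the expansions of α u x give the point
(`exists_point`). -/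

namespace Uniserial

/-! ### Substitution as a representation of the path algebra. -/

section Representation

variable {K : Type u} [Field K] {Γ : Type} [Quiver.{0} Γ] {a b : Γ}

theorem RightSubpath.eq_of_length {p : Quiver.Path a b} {x : Γ} {u v : RightSubpath p x}
    (h : u.1.length = v.1.length) : u = v :=
  RightSubpath.length_injective p x h

theorem IsRightSubpath.of_cons {p : Quiver.Path a b} {x y : Γ} {u : Quiver.Path a x} {α : x ⟶ y}
    (h : IsRightSubpath p (u.cons α)) : IsRightSubpath p u := by
  obtain ⟨w, hw⟩ := h
  refine ⟨α.toPath.comp w, ?_⟩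
  rw [← Quiver.Path.comp_assoc, Quiver.Path.comp_toPath_eq_cons, hw]

theorem IsRightSubpath.of_comp {p : Quiver.Path a b} {x y : Γ} {u : Quiver.Path a x}
    {w : Quiver.Path x y} (h : IsRightSubpath p (u.comp w)) : IsRightSubpath p u := by
  obtain ⟨w', hw⟩ := h
  exact ⟨w.comp w', by rw [← Quiver.Path.comp_assoc, hw]⟩

theorem IsRightSubpath.nil (p : Quiver.Path a b) : IsRightSubpath p Quiver.Path.nil :=
  ⟨p, Quiver.Path.nil_comp p⟩

/-- The trivial right subpath. -/
def RightSubpath.trivial (p : Quiver.Path a b) : RightSubpath p a :=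
  ⟨Quiver.Path.nil, IsRightSubpath.nil p⟩

theorem IsRightSubpath.length_le {p : Quiver.Path a b} {x : Γ} {u : Quiver.Path a x}
    (h : IsRightSubpath p u) : u.length ≤ p.length := by
  obtain ⟨w, rfl⟩ := h
  rw [Quiver.Path.length_comp]
  omega

/-- A right subpath is an initial segment of any right subpath that is at least as long. -/
theorem IsRightSubpath.exists_comp {p : Quiver.Path a b} {x y : Γ} {u : Quiver.Path a x}
    {v : Quiver.Path a y} (hu : IsRightSubpath p u) (hv : IsRightSubpath p v)
    (h : u.length ≤ v.length) : ∃ w : Quiver.Path x y, u.comp w = v := by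
  obtain ⟨z, u', w, rfl, hu'⟩ := v.exists_eq_comp_of_le_length h
  have h₁ := IsRightSubpath.of_comp hv
  obtain ⟨w₁, e₁⟩ := h₁
  obtain ⟨w₂, e₂⟩ := hu
  -- The vertex of `p` at position `u.length` is `z` by one decomposition and `x` by the other.
  have hz : z = x := by
    have e := congrArg (fun q : Quiver.Path a b => q.vertices[u.length]?) (e₁.trans e₂.symm)
    rw [← hu'] at e
    have g : ∀ {c : Γ} (q : Quiver.Path a c) (r : Quiver.Path c b),
        (q.comp r).vertices[q.length]? = some c := by
      intro c q r
      rw [Quiver.Path.vertices_comp, List.getElem?_append_right (by simp)]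
      simp
    rw [g, hu', g] at e
    exact Option.some.inj e
  subst hz
  obtain ⟨rfl, -⟩ := (Quiver.Path.comp_inj' hu').1 (e₁.trans e₂.symm)
  exact ⟨w, rfl⟩

theorem exists_rightSubpath_length (p : Quiver.Path a b) {i : ℕ} (hi : i ≤ p.length) :
    ∃ (x : Γ) (u : RightSubpath p x), u.1.length = i := by
  obtain ⟨x, u, w, rfl, hu⟩ := p.exists_eq_comp_of_le_length hi
  exact ⟨x, ⟨u, w, rfl⟩, hu⟩

/-- The substitution is strictly triangular: whichever rule applies, only right subpaths longer than
`u` occur. The length filtration rests on this. -/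
theorem substCoeff_eq_zero {A : Type*} [CommRing A] {p : Quiver.Path a b} {c : DetourVar p → A}
    {x y : Γ} {α : x ⟶ y} {u : RightSubpath p x} {v : RightSubpath p y}
    (h : v.1.length ≤ u.1.length) : substCoeff p c α u v = 0 := by
  rw [substCoeff]
  split_ifs with h₁ h₂ h₃
  · rw [h₂, Quiver.Path.length_cons] at h
    omega
  · rfl
  · omega
  · rfl

theorem substCoeff_eq_one {A : Type*} [CommRing A] {p : Quiver.Path a b} {c : DetourVar p → A}
    {x y : Γ} {α : x ⟶ y} {u : RightSubpath p x} {v : RightSubpath p y}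
    (h : v.1 = u.1.cons α) : substCoeff p c α u v = 1 := by
  rw [substCoeff, dif_pos (h ▸ v.2), if_pos h]

theorem substCoeff_of_ne {A : Type*} [CommRing A] {p : Quiver.Path a b} {c : DetourVar p → A}
    {x y : Γ} {α : x ⟶ y} {u : RightSubpath p x} {v : RightSubpath p y}
    (h : IsRightSubpath p (u.1.cons α)) (h' : v.1 ≠ u.1.cons α) : substCoeff p c α u v = 0 := by
  rw [substCoeff, dif_pos h, if_neg h']

theorem substCoeff_detour {A : Type*} [CommRing A] {p : Quiver.Path a b} {c : DetourVar p → A}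
    (δ : DetourVar p) : substCoeff p c δ.α δ.u δ.v = c δ := by
  rw [substCoeff, dif_neg δ.not_right, dif_pos δ.longer]

/-- The formal linear combinations of the right subpaths of `p`. -/
abbrev Comb (K : Type u) (p : Quiver.Path a b) : Type u := (y : Γ) → RightSubpath p y → K

variable (p : Quiver.Path a b) (k : DetourVar p → K)

/-- The action of a path on the combinations of the right subpaths ending where it starts. -/
noncomputable def act {c : Γ} :
    {d : Γ} → Quiver.Path c d → (RightSubpath p c → K) →ₗ[K] (RightSubpath p d → K)
  | _, .nil => LinearMap.id
  | _, .cons q α =>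
    LinearMap.pi (fun v => ∑ u, substCoeff p k α u v • LinearMap.proj u) ∘ₗ act q

theorem act_nil (c : Γ) : act p k (Quiver.Path.nil : Quiver.Path c c) = LinearMap.id := rfl

theorem act_cons {c d e : Γ} (q : Quiver.Path c d) (α : d ⟶ e) (m : RightSubpath p c → K)
    (v : RightSubpath p e) :
    act p k (q.cons α) m v = ∑ u, act p k q m u * substCoeff p k α u v := by
  simp [act, mul_comm]

theorem act_comp {c d e : Γ} (q : Quiver.Path c d) (r : Quiver.Path d e) :
    act p k (q.comp r) = act p k r ∘ₗ act p k q := by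
  induction r with
  | nil => rfl
  | cons r α ih => simp only [Quiver.Path.comp_cons, act, ih, LinearMap.comp_assoc]

/-- The combination of right subpaths consisting of the trivial path alone. -/
noncomputable def topComb (K : Type u) [Field K] (p : Quiver.Path a b) : Comb K p :=
  fun _ v => if v.1.length = 0 then 1 else 0

theorem topComb_ne {c : Γ} (h : c ≠ a) : topComb K p c = 0 := by
  funext v
  rw [topComb, if_neg fun h' => h (Quiver.Path.eq_of_length_zero _ h').symm]
  rfl

/-- Substituting successively from the right means letting the arrows act one after another on the
trivial path; this makes `reduce` accessible to linear algebra. -/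
theorem act_topComb {y : Γ} (q : Quiver.Path a y) (v : RightSubpath p y) :
    act p k q (topComb K p a) v = reduce p k q v := by
  induction q with
  | nil =>
    classical
    rw [act_nil, LinearMap.id_apply, topComb, reduce.eq_1]
    exact if_congr (Quiver.Path.length_eq_zero_iff v.1) rfl rfl
  | cons q α ih => simp only [act_cons, reduce, ih]

open scoped Classical in
theorem act_rightSubpath {y : Γ} {q : Quiver.Path a y} (hq : IsRightSubpath p q)
    (v : RightSubpath p y) : act p k q (topComb K p a) v = if v.1 = q then 1 else 0 := by
  induction q with
  | nil =>
    rw [act_nil, LinearMap.id_apply, topComb]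
    exact if_congr (Quiver.Path.length_eq_zero_iff v.1) rfl rfl
  | cons q α ih =>
    have hq' : IsRightSubpath p q := IsRightSubpath.of_cons hq
    let u : RightSubpath p _ := ⟨q, hq'⟩
    rw [act_cons]
    refine (Finset.sum_eq_single u (fun u' _ hne => ?_) (by simp)).trans ?_
    · rw [ih hq', if_neg fun h => hne (Subtype.ext h), zero_mul]
    · rw [ih hq', if_pos rfl, one_mul]
      split_ifs with h
      · exact substCoeff_eq_one (u := u) h
      · exact substCoeff_of_ne (u := u) hq h

/-- The action of a path strictly raises the length of the leading right subpath. -/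
theorem act_eq_zero {c d : Γ} (w : Quiver.Path c d) {m : RightSubpath p c → K} {i : ℕ}
    (hm : ∀ u, u.1.length < i → m u = 0) (v : RightSubpath p d)
    (hv : v.1.length < i + w.length) : act p k w m v = 0 := by
  induction w with
  | nil => exact hm v hv
  | cons w α ih =>
    rw [act_cons]
    refine Finset.sum_eq_zero fun u _ => ?_
    rw [Quiver.Path.length_cons] at hv
    by_cases h : u.1.length < i + w.length
    · rw [ih u h, zero_mul]
    · rw [substCoeff_eq_zero (by omega), mul_zero]

/-- The leading coefficient is preserved along `p`. -/
theorem act_leading {c d : Γ} (w : Quiver.Path c d) {m : RightSubpath p c → K}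
    (u : RightSubpath p c) (hm : ∀ u', u'.1.length < u.1.length → m u' = 0)
    (v : RightSubpath p d) (hv : u.1.comp w = v.1) : act p k w m v = m u := by
  induction w with
  | nil => exact congrArg m (Subtype.ext hv.symm)
  | cons w α ih =>
    have hu : IsRightSubpath p (u.1.comp w) :=
      IsRightSubpath.of_comp (w := α.toPath) (by
        rw [Quiver.Path.comp_toPath_eq_cons, ← Quiver.Path.comp_cons, hv]
        exact v.2)
    let u₁ : RightSubpath p _ := ⟨u.1.comp w, hu⟩
    have hlen : v.1.length = u₁.1.length + 1 := by
      rw [← hv]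
      rfl
    have hlen' : u₁.1.length = u.1.length + w.length := Quiver.Path.length_comp _ _
    -- Terms shorter than `u₁` vanish by `act_eq_zero`, longer ones contribute nothing to `v` by
    -- triangularity.
    rw [act_cons, Finset.sum_eq_single u₁]
    · rw [ih u₁ rfl, substCoeff_eq_one (u := u₁) hv.symm, mul_one]
    · intro u' _ hne
      by_cases h : u'.1.length < u.1.length + w.length
      · rw [act_eq_zero p k w hm u' h, zero_mul]
      · rw [substCoeff_eq_zero, mul_zero]
        have : u'.1.length ≠ u₁.1.length := fun h' => hne (RightSubpath.eq_of_length h')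
        omega
    · simp

open scoped Classical in
/-- The representation of the path algebra on the combinations of right subpaths of `p` in which
`α u` is given by the substitution equations with the values `k` of the variables. -/
noncomputable def rep : PathAlgebra K Γ →ₗ[K] Module.End K (Comb K p) :=
  (pathBasis K Γ).constr K fun q =>
    LinearMap.single K (fun y => RightSubpath p y → K) q.2.1 ∘ₗ act p k q.2.2 ∘ₗ
      LinearMap.proj q.1

open scoped Classical in
theorem rep_ofPath {c d : Γ} (q : Quiver.Path c d) (m : Comb K p) :
    rep p k (ofPath K q) m = Pi.single d (act p k q (m c)) := by
  rw [rep, ofPath, Module.Basis.constr_basis]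
  rfl

theorem rep_ofPath_same {c d : Γ} (q : Quiver.Path c d) (m : Comb K p) :
    rep p k (ofPath K q) m d = act p k q (m c) := by
  classical
  rw [rep_ofPath, Pi.single_eq_same]

theorem rep_ofPath_ne {c d e : Γ} (q : Quiver.Path c d) (m : Comb K p) (h : e ≠ d) :
    rep p k (ofPath K q) m e = 0 := by
  classical
  rw [rep_ofPath, Pi.single_eq_of_ne h]

variable [Fintype Γ]

/-- Concatenation is composition of operators by `act_comp`; if the paths do not compose, the image
of the first is supported at a vertex that the second ignores. -/
theorem rep_mul (x y : PathAlgebra K Γ) : rep p k (x * y) = rep p k x * rep p k y := by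
  classical
  have key : (mulHom K Γ).compr₂ (rep p k) =
      (LinearMap.mul K (Module.End K (Comb K p))).compl₁₂ (rep p k) (rep p k) := by
    refine lhom_ext fun c d q => lhom_ext fun e f r => ?_
    change rep p k (ofPath K q * ofPath K r) = rep p k (ofPath K q) * rep p k (ofPath K r)
    refine LinearMap.ext fun m => ?_
    rw [Module.End.mul_apply]
    by_cases h : f = c
    · subst h
      rw [ofPath_mul_ofPath_same, rep_ofPath, rep_ofPath, rep_ofPath_same, act_comp]
      rfl
    · rw [ofPath_mul_ofPath_ne _ _ h, map_zero, rep_ofPath, rep_ofPath_ne _ _ _ _ (Ne.symm h),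
        map_zero, Pi.single_zero, LinearMap.zero_apply]
  exact LinearMap.congr_fun (LinearMap.congr_fun key x) y

theorem rep_one : rep p k 1 = 1 := by
  classical
  rw [one_def, map_sum]
  refine LinearMap.ext fun m => ?_
  rw [LinearMap.sum_apply]
  simp only [vertexIdem, rep_ofPath, act_nil, LinearMap.id_apply]
  exact Finset.univ_sum_single m

/-- The combination of right subpaths into which an element of the path algebra is turned by the
substitution equations with the values `k` of the variables. -/
noncomputable def red : PathAlgebra K Γ →ₗ[K] Comb K p := (rep p k).flip (topComb K p)

theorem red_mul (w z : PathAlgebra K Γ) : red p k (w * z) = rep p k w (red p k z) := by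
  simp only [red, LinearMap.flip_apply, rep_mul, Module.End.mul_apply]

theorem red_one : red p k 1 = topComb K p := by
  rw [red, LinearMap.flip_apply, rep_one, Module.End.one_apply]

theorem red_ofPath {y : Γ} (q : Quiver.Path a y) (v : RightSubpath p y) :
    red p k (ofPath K q) y v = reduce p k q v := by
  rw [red, LinearMap.flip_apply, rep_ofPath_same, act_topComb]

theorem red_ofPath_of_ne {c d : Γ} (h : c ≠ a) (q : Quiver.Path c d) :
    red p k (ofPath K q) = 0 := by
  classical
  rw [red, LinearMap.flip_apply, rep_ofPath, topComb_ne p h, map_zero, Pi.single_zero]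

theorem red_vertexIdem : red p k (vertexIdem K a) = topComb K p := by
  classical
  rw [red, LinearMap.flip_apply, vertexIdem, rep_ofPath, act_nil, LinearMap.id_apply]
  funext y
  by_cases h : y = a
  · subst h
    rw [Pi.single_eq_same]
  · rw [Pi.single_eq_of_ne h, topComb_ne p h]

open scoped Classical in
/-- The right subpath `u` as a combination of right subpaths. -/
noncomputable def unitComb (K : Type u) [Field K] {p : Quiver.Path a b} {y : Γ}
    (u : RightSubpath p y) : Comb K p := Pi.single y (Pi.single u 1)

theorem red_rightSubpath {y : Γ} (u : RightSubpath p y) :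
    red p k (ofPath K u.1) = unitComb K u := by
  classical
  rw [red, LinearMap.flip_apply, rep_ofPath, unitComb]
  congr 1
  funext v
  rw [act_rightSubpath p k u.2, Pi.single_apply]
  exact if_congr Subtype.ext_iff.symm rfl rfl

/-- Combinations of right subpaths as elements of the path algebra. -/
noncomputable def nf : Comb K p →ₗ[K] PathAlgebra K Γ where
  toFun c := ∑ y, ∑ v : RightSubpath p y, c y v • ofPath K v.1
  map_add' c c' := by simp [add_smul, Finset.sum_add_distrib]
  map_smul' r c := by simp [mul_smul, Finset.smul_sum]

theorem nf_apply (c : Comb K p) : nf p c = ∑ y, ∑ v : RightSubpath p y, c y v • ofPath K v.1 := rfl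

theorem nf_single {y : Γ} [DecidableEq Γ] (m : RightSubpath p y → K) :
    nf p (Pi.single y m) = ∑ v, m v • ofPath K v.1 := by
  rw [nf_apply, Finset.sum_eq_single y]
  · simp
  · intro c _ hc
    simp [Pi.single_eq_of_ne hc]
  · simp

theorem nf_unitComb {y : Γ} (u : RightSubpath p y) : nf p (unitComb K u) = ofPath K u.1 := by
  classical
  rw [unitComb, nf_single]
  simp [Pi.single_apply]

theorem comb_eq_sum (c : Comb K p) : c = ∑ y, ∑ v : RightSubpath p y, c y v • unitComb K v := by
  classical
  funext y v
  simp only [Finset.sum_apply, Pi.smul_apply, unitComb]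
  rw [Finset.sum_eq_single y]
  · simp [Pi.single_apply]
  · intro y' _ h
    simp [Pi.single_eq_of_ne h.symm]
  · simp

/-- Right subpaths are normal forms, fixed by the substitution whatever the parameters are. -/
theorem red_nf (c : Comb K p) : red p k (nf p c) = c := by
  conv_rhs => rw [comb_eq_sum p c]
  simp only [nf_apply, map_sum, map_smul, red_rightSubpath]

omit [Fintype Γ] in
theorem eval_reduce {y : Γ} (q : Quiver.Path a y) (v : RightSubpath p y) :
    MvPolynomial.eval k (reduce p MvPolynomial.X q v) = reduce p k q v := by
  induction q with
  | nil =>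
    simp only [reduce]
    split_ifs <;> simp
  | cons q α ih =>
    simp only [reduce, map_sum, map_mul, ih]
    refine Finset.sum_congr rfl fun u _ => ?_
    congr 1
    simp only [substCoeff]
    split_ifs <;> simp

theorem red_apply (z : PathAlgebra K Γ) {y : Γ} (v : RightSubpath p y) :
    red p k z y v = ((pathBasis K Γ).repr z).sum fun q r => r * red p k (pathBasis K Γ q) y v := by
  conv_lhs => rw [← (pathBasis K Γ).linearCombination_repr z]
  simp [Finsupp.linearCombination_apply, Finsupp.sum]

/-- Both sides extend the substitution on paths linearly; paths not running from `a` to `y`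
contribute zero on the right. -/
theorem eval_tau (z : PathAlgebra K Γ) {y : Γ} (v : RightSubpath p y) :
    MvPolynomial.eval k (tau p z v) = red p k z y v := by
  classical
  have hinj : Function.Injective
      (fun q : Quiver.Path a y => (⟨a, y, q⟩ : Σ a b : Γ, Quiver.Path a b)) :=
    fun q q' h => by simpa using h
  rw [tau, red_apply, finsum_eq_sum_of_support_subset
    (s := ((pathBasis K Γ).repr z).support.preimage _ hinj.injOn)]
  · rw [map_sum, Finsupp.sum,
      ← Finset.sum_preimage _ _ hinj.injOn (fun q => (pathBasis K Γ).repr z q *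
        red p k (pathBasis K Γ q) y v)]
    · refine Finset.sum_congr rfl fun q _ => ?_
      rw [map_mul, MvPolynomial.eval_C, eval_reduce]
      exact congrArg _ (red_ofPath p k q v).symm
    · rintro ⟨c, d, q⟩ _ h
      refine mul_eq_zero_of_right _ ?_
      change red p k (ofPath K q) y v = 0
      by_cases hc : c = a
      · subst hc
        have hd : y ≠ d := by
          rintro rfl
          exact h ⟨q, rfl⟩
        rw [red, LinearMap.flip_apply, rep_ofPath_ne _ _ _ _ hd]
        rfl
      · rw [red_ofPath_of_ne p k hc]
        rfl
  · intro q hq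
    simp only [Finset.coe_preimage, Set.mem_preimage, Finset.mem_coe, Finsupp.mem_support_iff]
    intro h
    refine hq ?_
    have : coeff z q = 0 := h
    simp only [this, map_zero, zero_mul]

/-- By `eval_tau`, the vanishing of all τ at `k` says that `I` annihilates the top element of the
representation. -/
theorem mem_pathVariety {I : Ideal (PathAlgebra K Γ)} :
    k ∈ pathVariety I p ↔ ∀ z ∈ I, red p k z = 0 := by
  simp only [pathVariety, Set.mem_ofPred_eq, eval_tau, funext_iff]
  rfl

end Representation
-- The length filtration and the chain of submodules.
section Ideals

variable {K : Type u} [Field K] {Γ : Type} [Quiver.{0} Γ] {a b : Γ}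

theorem mem_of_forall_ofPath {N : Submodule K (PathAlgebra K Γ)}
    (h : ∀ (c d : Γ) (q : Quiver.Path c d), ofPath K q ∈ N) (z : PathAlgebra K Γ) : z ∈ N := by
  have : Submodule.span K (Set.range (pathBasis K Γ)) ≤ N :=
    Submodule.span_le.2 (by rintro _ ⟨⟨c, d, q⟩, rfl⟩; exact h c d q)
  exact this ((pathBasis K Γ).mem_span z)

theorem coeff_add (z w : PathAlgebra K Γ) (q : Quiver.Path a b) :
    coeff (z + w) q = coeff z q + coeff w q := by
  simp [coeff]

theorem coeff_sub (z w : PathAlgebra K Γ) (q : Quiver.Path a b) :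
    coeff (z - w) q = coeff z q - coeff w q := by
  simp [coeff]

theorem coeff_smul (c : K) (z : PathAlgebra K Γ) (q : Quiver.Path a b) :
    coeff (c • z) q = c * coeff z q := by
  simp [coeff]

theorem coeff_zero (q : Quiver.Path a b) : coeff (0 : PathAlgebra K Γ) q = 0 := by
  simp [coeff]

theorem coeff_ofPath_self (q : Quiver.Path a b) : coeff (ofPath K q) q = 1 := by
  rw [coeff, ofPath, Module.Basis.repr_self, Finsupp.single_eq_same]

theorem coeff_ofPath_ne {c d : Γ} {q : Quiver.Path a b} {r : Quiver.Path c d}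
    (h : (⟨c, d, r⟩ : Σ a b : Γ, Quiver.Path a b) ≠ ⟨a, b, q⟩) : coeff (ofPath K r) q = 0 := by
  rw [coeff, ofPath, Module.Basis.repr_self, Finsupp.single_eq_of_ne h.symm]

theorem coeff_ofPath_of_length_ne {c d : Γ} {q : Quiver.Path a b} {r : Quiver.Path c d}
    (h : r.length ≠ q.length) : coeff (ofPath K r) q = 0 :=
  coeff_ofPath_ne fun h' => h (congrArg (fun s : Σ a b : Γ, Quiver.Path a b => s.2.2.length) h')

/-- Left multiplication by an arrow, after the substitution. -/
theorem act_toPath (p : Quiver.Path a b) (k : DetourVar p → K) {x y : Γ} (α : x ⟶ y)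
    (m : RightSubpath p x → K) (v : RightSubpath p y) :
    act p k α.toPath m v = ∑ u, m u * substCoeff p k α u v := by
  rw [Quiver.Hom.toPath, act_cons, act_nil]
  rfl

variable [Fintype Γ] (p : Quiver.Path a b) (k : DetourVar p → K)

theorem rep_eq_zero {m : Comb K p} {i : ℕ} (hm : ∀ y v, v.1.length < i → m y v = 0)
    (w : PathAlgebra K Γ) (y : Γ) (v : RightSubpath p y) (hv : v.1.length < i) :
    rep p k w m y v = 0 := by
  let φ : PathAlgebra K Γ →ₗ[K] K :=
    LinearMap.proj v ∘ₗ LinearMap.proj y ∘ₗ (rep p k).flip m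
  refine mem_of_forall_ofPath (N := LinearMap.ker φ) (fun c d q => ?_) w
  change rep p k (ofPath K q) m y v = 0
  by_cases h : y = d
  · subst h
    rw [rep_ofPath_same]
    exact act_eq_zero p k q (hm c) v (by omega)
  · rw [rep_ofPath_ne _ _ _ _ h]
    rfl

/-- The left ideal of the elements that turn into combinations of right subpaths of length at
least `i`. -/
noncomputable def filtIdeal (i : ℕ) : Ideal (PathAlgebra K Γ) where
  carrier := {z | ∀ (y : Γ) (v : RightSubpath p y), v.1.length < i → red p k z y v = 0}
  add_mem' {z w} hz hw y v hv := by
    rw [map_add, Pi.add_apply, Pi.add_apply, hz y v hv, hw y v hv, add_zero]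
  zero_mem' y v _ := by
    rw [map_zero]
    rfl
  smul_mem' w z hz y v hv := by
    rw [smul_eq_mul, red_mul]
    exact rep_eq_zero p k hz w y v hv

/-- The left ideal of the elements that turn into zero. -/
noncomputable def redKer : Ideal (PathAlgebra K Γ) := filtIdeal p k (p.length + 1)

variable {p k}

theorem mem_filtIdeal {i : ℕ} {z : PathAlgebra K Γ} :
    z ∈ filtIdeal p k i ↔ ∀ (y : Γ) (v : RightSubpath p y), v.1.length < i → red p k z y v = 0 :=
  Iff.rfl

/-- Right subpaths have length at most `p.length`, so the bound `p.length + 1` in `redKer` covers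
every coefficient. -/
theorem mem_redKer {z : PathAlgebra K Γ} : z ∈ redKer p k ↔ red p k z = 0 := by
  refine mem_filtIdeal.trans ⟨fun h => ?_, fun h y v _ => by rw [h]; rfl⟩
  funext y v
  exact h y v (Nat.lt_succ_of_le v.2.length_le)

theorem filtIdeal_antitone {i j : ℕ} (h : i ≤ j) : filtIdeal p k j ≤ filtIdeal p k i :=
  fun _ hz y v hv => hz y v (by omega)

theorem redKer_le_filtIdeal (i : ℕ) : redKer p k ≤ filtIdeal p k i := by
  intro z hz
  rw [mem_redKer] at hz
  intro y v _
  rw [hz]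
  rfl

theorem filtIdeal_zero : filtIdeal p k 0 = ⊤ := by
  rw [eq_top_iff]
  intro z _ y v hv
  omega

theorem smul_mem_ideal {A : Ideal (PathAlgebra K Γ)} {z : PathAlgebra K Γ} (c : K) (hz : z ∈ A) :
    c • z ∈ A :=
  Submodule.smul_of_tower_mem A c hz

theorem mem_ideal_of_smul {A : Ideal (PathAlgebra K Γ)} {z : PathAlgebra K Γ} {c : K} (hc : c ≠ 0)
    (hz : c • z ∈ A) : z ∈ A := by
  have := smul_mem_ideal c⁻¹ hz
  rwa [smul_smul, inv_mul_cancel₀ hc, one_smul] at this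

theorem path_mem_filtIdeal {c d : Γ} (q : Quiver.Path c d) :
    ofPath K q ∈ filtIdeal p k q.length := by
  intro x v hv
  by_cases h : x = d
  · subst h
    rw [red, LinearMap.flip_apply, rep_ofPath_same]
    exact act_eq_zero p k q (i := 0) (fun _ h => absurd h (by omega)) v (by omega)
  · rw [red, LinearMap.flip_apply, rep_ofPath_ne _ _ _ _ h]
    rfl

theorem ofPath_mem_filtIdeal {y : Γ} (u : RightSubpath p y) :
    ofPath K u.1 ∈ filtIdeal p k u.1.length :=
  path_mem_filtIdeal u.1

/-- A combination of right subpaths of length at least `i` is, up to longer ones, a multiple of the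
right subpath of length `i`. -/
theorem sub_smul_mem_filtIdeal {z z' : PathAlgebra K Γ} {y : Γ} (u : RightSubpath p y)
    (hz : z ∈ filtIdeal p k u.1.length) (hz' : z' ∈ filtIdeal p k u.1.length)
    (h : red p k z' y u ≠ 0) :
    z - (red p k z y u / red p k z' y u) • z' ∈ filtIdeal p k (u.1.length + 1) := by
  intro x v hv
  rw [map_sub, map_smul, Pi.sub_apply, Pi.sub_apply, Pi.smul_apply, Pi.smul_apply, smul_eq_mul]
  by_cases hlt : v.1.length < u.1.length
  · rw [hz x v hlt, hz' x v hlt, mul_zero, sub_zero]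
  · have hlen : u.1.length = v.1.length := by omega
    -- There is one right subpath of each length, whatever its end, so `v = u`, where the chosen
    -- scalar cancels the coefficient.
    obtain ⟨w, hw⟩ := u.2.exists_comp v.2 hlen.le
    have hl := congrArg Quiver.Path.length hw
    rw [Quiver.Path.length_comp] at hl
    obtain rfl : y = x := Quiver.Path.eq_of_length_zero w (by omega)
    obtain rfl : u = v := RightSubpath.eq_of_length hlen
    rw [div_mul_cancel₀ _ h, sub_self]

theorem red_ofPath_self {y : Γ} (u : RightSubpath p y) : red p k (ofPath K u.1) y u = 1 := by
  classical
  rw [red_ofPath, ← act_topComb, act_rightSubpath p k u.2, if_pos rfl]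

/-- Every element is congruent to the combination of right subpaths into which it turns. -/
theorem sub_nf_mem {A : Ideal (PathAlgebra K Γ)} (hA : 1 - vertexIdem K a ∈ A)
    (hA' : ∀ (x y : Γ) (α : x ⟶ y) (u : RightSubpath p x),
      ofPath K (u.1.cons α) - ∑ v, substCoeff p k α u v • ofPath K v.1 ∈ A)
    (z : PathAlgebra K Γ) : z - nf p (red p k z) ∈ A := by
  classical
  refine mem_of_forall_ofPath (N := (A.restrictScalars K).comap
    (LinearMap.id - nf p ∘ₗ red p k)) (fun c d q => ?_) z
  change ofPath K q - nf p (red p k (ofPath K q)) ∈ A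
  by_cases hc : c = a
  · subst hc
    have hred : ∀ {d : Γ} (q : Quiver.Path c d),
        red p k (ofPath K q) = Pi.single d (act p k q (topComb K p c)) := fun q => by
      rw [red, LinearMap.flip_apply, rep_ofPath]
    rw [hred]
    induction q with
    | nil =>
      have : (Pi.single c (act p k Quiver.Path.nil (topComb K p c)) : Comb K p) =
          unitComb K (RightSubpath.trivial p) := by
        rw [← hred]
        exact red_rightSubpath p k (RightSubpath.trivial p)
      rw [this, nf_unitComb, RightSubpath.trivial, sub_self]
      exact A.zero_mem
    | @cons x y q α ih =>
      set m := act p k q (topComb K p c) with hm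
      have e₁ : ofPath K (q.cons α) = ofPath K α.toPath * ofPath K q :=
        (ofPath_mul_ofPath_same α.toPath q).symm
      -- Rewriting `α` times a normal form uses one relation per right subpath `u`, weighted by its
      -- coefficient `m u`.
      have e₂ : ofPath K α.toPath * nf p (Pi.single x m) -
          nf p (Pi.single y (act p k (q.cons α) (topComb K p c))) =
          ∑ u, m u • (ofPath K (u.1.cons α) - ∑ v, substCoeff p k α u v • ofPath K v.1) := by
        rw [nf_single, nf_single, Finset.mul_sum]
        simp only [smul_sub, Finset.sum_sub_distrib, mul_smul_comm, ofPath_mul_ofPath_same,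
          act_cons, Finset.sum_smul, Finset.smul_sum, smul_smul]
        congr 1
        exact Finset.sum_comm
      have e₃ := A.mul_mem_left (ofPath K α.toPath) ih
      have e₄ := A.sum_mem (t := Finset.univ) fun u _ => smul_mem_ideal (m u) (hA' x y α u)
      rw [← e₂] at e₄
      have e₅ := A.add_mem e₃ e₄
      rwa [mul_sub, sub_add_sub_cancel, ← e₁] at e₅
  · rw [red_ofPath_of_ne p k hc, map_zero, sub_zero]
    -- As `q` does not start at `a`, it equals `q * (1 - vertexIdem K a)`.
    have := A.mul_mem_left (ofPath K q) hA
    rwa [mul_sub, mul_one, vertexIdem, ofPath_mul_ofPath_ne _ _ (Ne.symm hc), sub_zero] at this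

theorem one_sub_mem_redKer : 1 - vertexIdem K a ∈ redKer p k := by
  rw [mem_redKer, map_sub, red_one, red_vertexIdem, sub_self]

theorem relation_mem_redKer {x y : Γ} (α : x ⟶ y) (u : RightSubpath p x) :
    ofPath K (u.1.cons α) - ∑ v, substCoeff p k α u v • ofPath K v.1 ∈ redKer p k := by
  classical
  rw [mem_redKer, map_sub, sub_eq_zero, ← nf_single, red_nf, ← Quiver.Path.comp_toPath_eq_cons,
    ← ofPath_mul_ofPath_same, red_mul, red_rightSubpath, rep_ofPath]
  congr 1
  funext v
  rw [act_toPath, unitComb, Pi.single_eq_same, Finset.sum_eq_single u]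
  · rw [Pi.single_eq_same, one_mul]
  · intro u' _ h
    rw [Pi.single_eq_of_ne h, zero_mul]
  · simp

variable {I : Ideal (PathAlgebra K Γ)} [I.IsTwoSided]

/-- For `k` in the variety, the kernel of the substitution is the annihilator of the canonical
generator. -/
theorem mk_mem_defIdeal (hk : k ∈ pathVariety I p) {z : PathAlgebra K Γ} :
    Ideal.Quotient.mk I z ∈ defIdeal I p k ↔ red p k z = 0 := by
  rw [mem_pathVariety] at hk
  rw [← mem_redKer]
  constructor
  · intro h
    -- The generators come from `redKer`. Since `k` is in the variety, `I` is contained in `redKer`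
    -- too, so membership can be pulled back from the quotient.
    have hle : defIdeal I p k ≤ Ideal.map (Ideal.Quotient.mk I) (redKer p k) := by
      refine Ideal.span_le.2 ?_
      rintro _ (h | ⟨x, y, α, u, rfl⟩)
      · rw [Set.mem_singleton_iff] at h
        rw [h, ← map_one (Ideal.Quotient.mk I), ← map_sub]
        exact Ideal.mem_map_of_mem _ one_sub_mem_redKer
      · exact Ideal.mem_map_of_mem _ (relation_mem_redKer α u)
    obtain ⟨z', hz', e⟩ := (Ideal.mem_map_iff_of_surjective _ Ideal.Quotient.mk_surjective).1 (hle h)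
    have e' := hk _ (Ideal.Quotient.eq.1 e)
    rw [mem_redKer] at hz' ⊢
    rw [map_sub, hz', zero_sub, neg_eq_zero] at e'
    exact e'
  · intro h
    rw [mem_redKer] at h
    have := sub_nf_mem (p := p) (k := k) (A := Ideal.comap (Ideal.Quotient.mk I) (defIdeal I p k))
      ?_ ?_ z
    · rw [h, map_zero, sub_zero] at this
      exact this
    · rw [Ideal.mem_comap, map_sub, map_one]
      exact Ideal.subset_span (Or.inl rfl)
    · intro x y α u
      exact Ideal.subset_span (Or.inr ⟨x, y, α, u, rfl⟩)

/-- Multiplying `z` by the piece of `p` from `u` to a longer right subpath `v` gives an element with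
leading term `v` (`act_leading`). Descending induction on the length, starting above `p.length`,
fills up the filtration. -/
theorem filtIdeal_le {N : Ideal (PathAlgebra K Γ)} (hN : redKer p k ≤ N) {y : Γ}
    (u : RightSubpath p y) {z : PathAlgebra K Γ} (hz : z ∈ N) (hz' : z ∈ filtIdeal p k u.1.length)
    (h : red p k z y u ≠ 0) : filtIdeal p k u.1.length ≤ N := by
  suffices ∀ n j, j + n = p.length + 1 → u.1.length ≤ j → filtIdeal p k j ≤ N from
    this (p.length + 1 - u.1.length) u.1.length
      (by have := u.2.length_le; omega) le_rfl
  intro n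
  induction n with
  | zero =>
    rintro j rfl _
    exact hN
  | succ n ih =>
    intro j hj huj w hw
    obtain ⟨x, v, rfl⟩ := exists_rightSubpath_length p (i := j) (by omega)
    obtain ⟨r, hr⟩ := u.2.exists_comp v.2 huj
    have hl := congrArg Quiver.Path.length hr
    rw [Quiver.Path.length_comp] at hl
    have hm : ofPath K r * z ∈ filtIdeal p k v.1.length := by
      intro x' v' hv'
      rw [red_mul]
      by_cases hx : x' = x
      · subst hx
        rw [rep_ofPath_same]
        exact act_eq_zero p k r (hz' y) v' (by omega)
      · rw [rep_ofPath_ne _ _ _ _ hx]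
        rfl
    have hc : red p k (ofPath K r * z) x v ≠ 0 := by
      rw [red_mul, rep_ofPath_same, act_leading p k r u (hz' y) v hr]
      exact h
    have e := ih (v.1.length + 1) (by omega) (by omega) (sub_smul_mem_filtIdeal v hw hm hc)
    have e' := N.add_mem e (smul_mem_ideal (red p k w x v / red p k (ofPath K r * z) x v)
      (N.mul_mem_left (ofPath K r) hz))
    rwa [sub_add_cancel] at e'

theorem exists_leading {z : PathAlgebra K Γ} (hz : red p k z ≠ 0) :
    ∃ (y : Γ) (u : RightSubpath p y), z ∈ filtIdeal p k u.1.length ∧ red p k z y u ≠ 0 := by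
  classical
  have hex : ∃ i, ∃ (y : Γ) (u : RightSubpath p y), u.1.length = i ∧ red p k z y u ≠ 0 := by
    by_contra! h
    exact hz (funext fun y => funext fun u => h _ y u rfl)
  obtain ⟨y, u, hu, hne⟩ := Nat.find_spec hex
  refine ⟨y, u, fun x v hv => ?_, hne⟩
  by_contra hne'
  exact Nat.find_min hex (hu ▸ hv) ⟨x, v, rfl, hne'⟩

/-- Of two elements witnessing failed inclusions, the one with the shorter leading term forces the
other into its ideal by `filtIdeal_le`. -/
theorem ideal_chain {N N' : Ideal (PathAlgebra K Γ)} (hN : redKer p k ≤ N) (hN' : redKer p k ≤ N') :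
    N ≤ N' ∨ N' ≤ N := by
  by_contra! h
  obtain ⟨z, hz, hz'⟩ := Set.not_subset.1 h.1
  obtain ⟨w, hw, hw'⟩ := Set.not_subset.1 h.2
  obtain ⟨x, u, hu, hu'⟩ := exists_leading (p := p) (k := k) (z := z)
    fun h0 => hz' (hN' (mem_redKer.2 h0))
  obtain ⟨y, v, hv, hv'⟩ := exists_leading (p := p) (k := k) (z := w)
    fun h0 => hw' (hN (mem_redKer.2 h0))
  rcases le_total u.1.length v.1.length with hle | hle
  · exact hw' (filtIdeal_le hN u hz hu hu' (filtIdeal_antitone hle hv))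
  · exact hz' (filtIdeal_le hN' v hw hv hv' (filtIdeal_antitone hle hu))

/-- The preimage in the path algebra of a submodule of a quotient of `K Γ / I`. -/
noncomputable def pullIdeal {D : Ideal (PathAlgebra K Γ ⧸ I)} (N : Submodule (PathAlgebra K Γ ⧸ I)
    ((PathAlgebra K Γ ⧸ I) ⧸ D)) : Ideal (PathAlgebra K Γ) :=
  Ideal.comap (Ideal.Quotient.mk I) (N.comap D.mkQ)

theorem isUniserial_quotient (hk : k ∈ pathVariety I p) :
    IsUniserial (PathAlgebra K Γ ⧸ I) ((PathAlgebra K Γ ⧸ I) ⧸ defIdeal I p k) := by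
  have hle : ∀ N : Submodule (PathAlgebra K Γ ⧸ I) ((PathAlgebra K Γ ⧸ I) ⧸ defIdeal I p k),
      redKer p k ≤ pullIdeal N := by
    intro N z hz
    have : (defIdeal I p k).mkQ (Ideal.Quotient.mk I z) = 0 :=
      (Submodule.Quotient.mk_eq_zero _).2 ((mk_mem_defIdeal hk).2 (mem_redKer.1 hz))
    change (defIdeal I p k).mkQ (Ideal.Quotient.mk I z) ∈ N
    rw [this]
    exact N.zero_mem
  have hmono : ∀ N N' : Submodule (PathAlgebra K Γ ⧸ I)
      ((PathAlgebra K Γ ⧸ I) ⧸ defIdeal I p k), pullIdeal N ≤ pullIdeal N' → N ≤ N' := by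
    intro N N' h t ht
    obtain ⟨s, rfl⟩ := Submodule.mkQ_surjective _ t
    obtain ⟨z, rfl⟩ := Ideal.Quotient.mk_surjective s
    exact h (x := z) ht
  intro N N'
  exact (ideal_chain (hle N) (hle N')).imp (hmono N N') (hmono N' N)

end Ideals
-- Simple modules at vertices, composition factors, injectivity of Φ.
section Modules

theorem nonempty_quotient_equiv {R : Type*} [Ring R] {T : Type*} [AddCommGroup T] [Module R T]
    {D : Ideal R} {t : T} (hgen : ∀ s : T, ∃ r : R, r • t = s)
    (hD : ∀ r : R, r • t = 0 ↔ r ∈ D) : Nonempty ((R ⧸ D) ≃ₗ[R] T) := by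
  have hker : D = LinearMap.ker (LinearMap.toSpanSingleton R T t) := by
    ext r
    rw [LinearMap.mem_ker, LinearMap.toSpanSingleton_apply, hD]
  exact ⟨(Submodule.quotEquivOfEq _ _ hker).trans
    ((LinearMap.toSpanSingleton R T t).quotKerEquivOfSurjective hgen)⟩

variable {K : Type u} [Field K] {Γ : Type} [Quiver.{0} Γ] [Fintype Γ] {a b : Γ}

/-- A product of paths is trivial only if both factors are; this is the one-dimensional
representation at `e`. -/
theorem coeff_mul_nil (e : Γ) (w z : PathAlgebra K Γ) :
    coeff (w * z) (Quiver.Path.nil : Quiver.Path e e) =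
      coeff w (Quiver.Path.nil : Quiver.Path e e) * coeff z (Quiver.Path.nil : Quiver.Path e e) := by
  let φ : PathAlgebra K Γ →ₗ[K] K := (pathBasis K Γ).coord ⟨e, e, Quiver.Path.nil⟩
  have key : (mulHom K Γ).compr₂ φ = (LinearMap.mul K K).compl₁₂ φ φ := by
    refine lhom_ext fun c d q => lhom_ext fun f d' r => ?_
    change coeff (ofPath K q * ofPath K r) (Quiver.Path.nil : Quiver.Path e e) =
      coeff (ofPath K q) (Quiver.Path.nil : Quiver.Path e e) *
        coeff (ofPath K r) (Quiver.Path.nil : Quiver.Path e e)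
    by_cases h : d' = c
    · subst h
      rw [ofPath_mul_ofPath_same]
      cases q with
      | cons q α =>
        rw [coeff_ofPath_of_length_ne (r := r.comp (q.cons α)) (by simp),
          coeff_ofPath_of_length_ne (r := q.cons α) (by simp), zero_mul]
      | nil =>
        rw [Quiver.Path.comp_nil]
        cases r with
        | cons r α => rw [coeff_ofPath_of_length_ne (r := r.cons α) (by simp), mul_zero]
        | nil =>
          by_cases he : d = e
          · subst he
            rw [coeff_ofPath_self, mul_one]
          · rw [coeff_ofPath_ne (by simp [he]), mul_zero]
    · rw [ofPath_mul_ofPath_ne _ _ h, coeff_zero]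
      by_cases hq : (⟨c, d, q⟩ : Σ a b : Γ, Quiver.Path a b) = ⟨e, e, Quiver.Path.nil⟩
      · rw [coeff_ofPath_ne (r := r), mul_zero]
        intro hr
        refine h ?_
        have h₁ := congrArg (fun s : Σ a b : Γ, Quiver.Path a b => s.2.1) hr
        have h₂ := congrArg (fun s : Σ a b : Γ, Quiver.Path a b => s.1) hq
        exact h₁.trans h₂.symm
      · rw [coeff_ofPath_ne hq, zero_mul]
  exact LinearMap.congr_fun (LinearMap.congr_fun key w) z

omit [Fintype Γ] in
theorem coeff_vertexIdem_self (e : Γ) :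
    coeff (vertexIdem K e) (Quiver.Path.nil : Quiver.Path e e) = 1 :=
  coeff_ofPath_self _

omit [Fintype Γ] in
theorem coeff_vertexIdem_ne {e c : Γ} (h : c ≠ e) :
    coeff (vertexIdem K c) (Quiver.Path.nil : Quiver.Path e e) = 0 :=
  coeff_ofPath_ne (by simp [h])

theorem coeff_one_nil (e : Γ) :
    coeff (1 : PathAlgebra K Γ) (Quiver.Path.nil : Quiver.Path e e) = 1 := by
  have h := coeff_mul_nil e (1 : PathAlgebra K Γ) (vertexIdem K e)
  rwa [one_mul, coeff_vertexIdem_self, mul_one, eq_comm] at h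

/-- The left ideal of the elements in which the trivial path at `e` does not occur. -/
noncomputable def nilIdeal (K : Type u) [Field K] (e : Γ) : Ideal (PathAlgebra K Γ) where
  carrier := {z | coeff z (Quiver.Path.nil : Quiver.Path e e) = 0}
  add_mem' {z w} hz hw := by
    simp only [Set.mem_ofPred_eq] at hz hw ⊢
    rw [coeff_add, hz, hw, add_zero]
  zero_mem' := coeff_zero _
  smul_mem' w z hz := by
    simp only [Set.mem_ofPred_eq] at hz ⊢
    rw [smul_eq_mul, coeff_mul_nil, hz, mul_zero]

theorem mem_nilIdeal {e : Γ} {z : PathAlgebra K Γ} :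
    z ∈ nilIdeal K e ↔ coeff z (Quiver.Path.nil : Quiver.Path e e) = 0 := Iff.rfl

variable (I : Ideal (PathAlgebra K Γ)) [I.IsTwoSided]

/-- The maximal left ideal of `K Γ / I` belonging to the vertex `e`. -/
noncomputable def vertexIdeal (e : Γ) : Ideal (PathAlgebra K Γ ⧸ I) :=
  Ideal.map (Ideal.Quotient.mk I) (nilIdeal K e)

/-- The simple left `K Γ / I`-module at the vertex `e`. -/
noncomputable def simpleAt (e : Γ) : ModuleCat.{u} (PathAlgebra K Γ ⧸ I) :=
  ModuleCat.of _ ((PathAlgebra K Γ ⧸ I) ⧸ vertexIdeal I e)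

variable {I}

omit [I.IsTwoSided] in
theorem IsAdmissible.le_nilIdeal (hI : IsAdmissible I) (e : Γ) : I ≤ nilIdeal K e := by
  intro z hz
  by_contra h
  have := hI.1 z hz e e Quiver.Path.nil h
  rw [Quiver.Path.length_nil] at this
  omega

theorem mk_mem_vertexIdeal (hI : IsAdmissible I) {e : Γ} {z : PathAlgebra K Γ} :
    Ideal.Quotient.mk I z ∈ vertexIdeal I e ↔
      coeff z (Quiver.Path.nil : Quiver.Path e e) = 0 := by
  refine ⟨fun h => ?_, fun h => Ideal.mem_map_of_mem _ (mem_nilIdeal.2 h)⟩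
  obtain ⟨z', hz', e'⟩ := (Ideal.mem_map_iff_of_surjective _ Ideal.Quotient.mk_surjective).1 h
  have := hI.le_nilIdeal e (Ideal.Quotient.eq.1 e')
  have := (nilIdeal K e).sub_mem hz' this
  rwa [sub_sub_cancel, mem_nilIdeal] at this

/-- Admissibility puts `I` inside `nilIdeal`, so the coefficient of the trivial path at `e`
identifies the quotient with `K`. -/
theorem isSimpleAt_simpleAt (hI : IsAdmissible I) (e : Γ) : IsSimpleAt I e (simpleAt I e) := by
  constructor
  · refine isSimpleModule_iff_isCoatom.2 ⟨?_, fun N hN => ?_⟩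
    · rw [Ne, Ideal.eq_top_iff_one, ← map_one (Ideal.Quotient.mk I), mk_mem_vertexIdeal hI,
        coeff_one_nil]
      exact one_ne_zero
    · obtain ⟨s, hs, hs'⟩ := Set.exists_of_ssubset hN
      obtain ⟨z, rfl⟩ := Ideal.Quotient.mk_surjective s
      rw [SetLike.mem_coe, mk_mem_vertexIdeal hI] at hs'
      rw [Ideal.eq_top_iff_one, ← map_one (Ideal.Quotient.mk I)]
      set c := coeff z (Quiver.Path.nil : Quiver.Path e e) with hc
      have h₁ : Ideal.Quotient.mk I (1 - c⁻¹ • z) ∈ N := by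
        refine hN.le ((mk_mem_vertexIdeal hI).2 ?_)
        rw [coeff_sub, coeff_one_nil, coeff_smul, inv_mul_cancel₀ hs', sub_self]
      have h₂ : Ideal.Quotient.mk I (c⁻¹ • z) ∈ N :=
        smul_mem_ideal (A := Ideal.comap (Ideal.Quotient.mk I) N) c⁻¹ hs
      have := N.add_mem h₁ h₂
      rwa [← map_add, sub_add_cancel] at this
  · refine ⟨Submodule.Quotient.mk 1, fun h => ?_⟩
    have h' : Ideal.Quotient.mk I (vertexIdem K e) * 1 ∈ vertexIdeal I e :=
      (Submodule.Quotient.mk_eq_zero _).1 h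
    rw [mul_one, mk_mem_vertexIdeal hI, coeff_vertexIdem_self] at h'
    exact one_ne_zero h'

/-- The elements of the path algebra that send `x` into `N`. -/
def actIdeal {U : Type*} [AddCommGroup U] [Module (PathAlgebra K Γ ⧸ I) U]
    (N : Submodule (PathAlgebra K Γ ⧸ I) U) (x : U) : Ideal (PathAlgebra K Γ) where
  carrier := {z | Ideal.Quotient.mk I z • x ∈ N}
  add_mem' {z w} hz hw := by
    simp only [Set.mem_ofPred_eq] at hz hw ⊢
    rw [map_add, add_smul]
    exact N.add_mem hz hw
  zero_mem' := by
    simp only [Set.mem_ofPred_eq]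
    rw [map_zero, zero_smul]
    exact N.zero_mem
  smul_mem' w z hz := by
    simp only [Set.mem_ofPred_eq] at hz ⊢
    rw [smul_eq_mul, map_mul, mul_smul]
    exact N.smul_mem _ hz

theorem mem_actIdeal {U : Type*} [AddCommGroup U] [Module (PathAlgebra K Γ ⧸ I) U]
    {N : Submodule (PathAlgebra K Γ ⧸ I) U} {x : U} {z : PathAlgebra K Γ} :
    z ∈ actIdeal N x ↔ Ideal.Quotient.mk I z • x ∈ N := Iff.rfl

section Canonical

variable {p : Quiver.Path a b} {k : DetourVar p → K}

/-- Paths of positive length push `u` into strictly longer right subpaths, so only the trivial path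
at `y` contributes. Hence the layer of `u` is the simple module at its end. -/
theorem red_mul_rightSubpath {y : Γ} (u : RightSubpath p y) (z : PathAlgebra K Γ) :
    red p k (z * ofPath K u.1) y u = coeff z (Quiver.Path.nil : Quiver.Path y y) := by
  let φ : PathAlgebra K Γ →ₗ[K] K :=
    LinearMap.proj u ∘ₗ LinearMap.proj y ∘ₗ red p k ∘ₗ (mulHom K Γ).flip (ofPath K u.1)
  have key : φ = (pathBasis K Γ).coord ⟨y, y, Quiver.Path.nil⟩ := by
    refine lhom_ext fun c d q => ?_
    change red p k (ofPath K q * ofPath K u.1) y u =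
      coeff (ofPath K q) (Quiver.Path.nil : Quiver.Path y y)
    by_cases h : y = c
    · subst h
      cases q with
      | nil => rw [coeff_ofPath_self, ofPath_mul_ofPath_same, Quiver.Path.comp_nil,
          red_ofPath_self]
      | cons q α =>
        rw [coeff_ofPath_of_length_ne (r := q.cons α) (by simp)]
        rw [red_mul]
        by_cases hd : y = d
        · subst hd
          rw [rep_ofPath_same]
          exact act_eq_zero p k (q.cons α) (ofPath_mem_filtIdeal u y) u (by simp)
        · rw [rep_ofPath_ne _ _ _ _ hd]
          rfl
    · rw [ofPath_mul_ofPath_ne _ _ h, map_zero, coeff_ofPath_ne]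
      · rfl
      · intro h'
        exact h (congrArg (fun s : Σ a b : Γ, Quiver.Path a b => s.1) h').symm
  exact LinearMap.congr_fun key z

theorem mul_mem_filtIdeal_succ {y : Γ} (u : RightSubpath p y) (z : PathAlgebra K Γ) :
    z * ofPath K u.1 ∈ filtIdeal p k (u.1.length + 1) ↔
      coeff z (Quiver.Path.nil : Quiver.Path y y) = 0 := by
  have h₁ : z * ofPath K u.1 ∈ filtIdeal p k u.1.length :=
    Ideal.mul_mem_left _ _ (ofPath_mem_filtIdeal u)
  have h₂ := sub_smul_mem_filtIdeal (k := k) u h₁ (ofPath_mem_filtIdeal u)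
    (by rw [red_ofPath_self]; exact one_ne_zero)
  rw [red_mul_rightSubpath, red_ofPath_self, div_one] at h₂
  constructor
  · intro h
    have := h y u (Nat.lt_succ_self _)
    rwa [red_mul_rightSubpath] at this
  · intro h
    rwa [h, zero_smul, sub_zero] at h₂

variable (I p k) in
/-- The canonical filtration of the module with the parameters `k`. -/
noncomputable def canonFilt (i : ℕ) :
    Submodule (PathAlgebra K Γ ⧸ I) ((PathAlgebra K Γ ⧸ I) ⧸ defIdeal I p k) :=
  Submodule.map (defIdeal I p k).mkQ (Ideal.map (Ideal.Quotient.mk I) (filtIdeal p k i))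

theorem mem_canonFilt (hk : k ∈ pathVariety I p) {i : ℕ} {z : PathAlgebra K Γ} :
    (defIdeal I p k).mkQ (Ideal.Quotient.mk I z) ∈ canonFilt I p k i ↔ z ∈ filtIdeal p k i := by
  constructor
  · rintro ⟨s, hs, e⟩
    obtain ⟨w, hw, rfl⟩ := (Ideal.mem_map_iff_of_surjective _ Ideal.Quotient.mk_surjective).1 hs
    rw [← sub_eq_zero, ← map_sub, ← map_sub, Submodule.mkQ_apply, Submodule.Quotient.mk_eq_zero,
      mk_mem_defIdeal hk, ← mem_redKer] at e
    have := (filtIdeal p k i).sub_mem hw (redKer_le_filtIdeal i e)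
    rwa [sub_sub_cancel] at this
  · exact fun h => Submodule.mem_map_of_mem (Ideal.mem_map_of_mem _ h)

/-- The length filtration is the composition series: its `i`-th layer is spanned by the right
subpath of length `i`, whose annihilator there is `vertexIdeal`. -/
theorem hasCompositionFactors_quotient (hI : IsAdmissible I) (hk : k ∈ pathVariety I p) {l : ℕ}
    (hl : p.length = l) (e : Fin (l + 1) → Γ)
    (he : ∀ i, ∃ u : RightSubpath p (e i), u.1.length = i) :
    HasCompositionFactors (PathAlgebra K Γ ⧸ I) ((PathAlgebra K Γ ⧸ I) ⧸ defIdeal I p k)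
      fun i => simpleAt I (e i) := by
  have hsurj : ∀ t : (PathAlgebra K Γ ⧸ I) ⧸ defIdeal I p k,
      ∃ z, (defIdeal I p k).mkQ (Ideal.Quotient.mk I z) = t := fun t => by
    obtain ⟨s, rfl⟩ := Submodule.mkQ_surjective _ t
    obtain ⟨z, rfl⟩ := Ideal.Quotient.mk_surjective s
    exact ⟨z, rfl⟩
  have hanti : ∀ i : ℕ, canonFilt I p k (i + 1) ≤ canonFilt I p k i := fun i t ht => by
    obtain ⟨z, rfl⟩ := hsurj t
    rw [mem_canonFilt hk] at ht ⊢
    exact filtIdeal_antitone (Nat.le_succ i) ht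
  refine ⟨fun i => canonFilt I p k i, ?_, ?_, fun i => ⟨hanti i, ?_⟩⟩
  · rw [eq_top_iff]
    intro t _
    obtain ⟨z, rfl⟩ := hsurj t
    simp only [Fin.val_zero]
    rw [mem_canonFilt hk, filtIdeal_zero]
    trivial
  · rw [eq_bot_iff]
    intro t ht
    obtain ⟨z, rfl⟩ := hsurj t
    simp only [Fin.val_last] at ht
    rw [mem_canonFilt hk, ← hl] at ht
    exact (Submodule.Quotient.mk_eq_zero _).2 ((mk_mem_defIdeal hk).2 (mem_redKer.1 ht))
  · obtain ⟨u, hu⟩ := he i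
    have hmem : (defIdeal I p k).mkQ (Ideal.Quotient.mk I (ofPath K u.1)) ∈ canonFilt I p k i := by
      rw [mem_canonFilt hk, ← hu]
      exact ofPath_mem_filtIdeal u
    have hact : ∀ z, Ideal.Quotient.mk I z •
        (defIdeal I p k).mkQ (Ideal.Quotient.mk I (ofPath K u.1)) =
        (defIdeal I p k).mkQ (Ideal.Quotient.mk I (z * ofPath K u.1)) := fun z => by
      rw [map_mul, ← map_smul, smul_eq_mul]
    refine (nonempty_quotient_equiv
      (T := canonFilt I p k i ⧸ (canonFilt I p k (i + 1)).submoduleOf (canonFilt I p k i))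
      (D := vertexIdeal I (e i)) (t := Submodule.Quotient.mk ⟨_, hmem⟩) ?_ ?_).map LinearEquiv.symm
    · intro s
      obtain ⟨⟨t, ht⟩, rfl⟩ := Submodule.Quotient.mk_surjective _ s
      obtain ⟨z, rfl⟩ := hsurj t
      refine ⟨Ideal.Quotient.mk I (red p k z (e i) u • 1), ?_⟩
      rw [← Submodule.Quotient.mk_smul, eq_comm, ← sub_eq_zero, ← Submodule.Quotient.mk_sub,
        Submodule.Quotient.mk_eq_zero]
      change (defIdeal I p k).mkQ (Ideal.Quotient.mk I z) - Ideal.Quotient.mk I _ •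
        (defIdeal I p k).mkQ (Ideal.Quotient.mk I (ofPath K u.1)) ∈ canonFilt I p k (i + 1)
      rw [hact, ← map_sub, ← map_sub, mem_canonFilt hk, smul_mul_assoc, one_mul, ← hu]
      rw [mem_canonFilt hk, ← hu] at ht
      have := sub_smul_mem_filtIdeal (k := k) u ht (ofPath_mem_filtIdeal u)
        (by rw [red_ofPath_self]; exact one_ne_zero)
      rwa [red_ofPath_self, div_one] at this
    · intro r
      obtain ⟨z, rfl⟩ := Ideal.Quotient.mk_surjective r
      rw [mk_mem_vertexIdeal hI, ← mul_mem_filtIdeal_succ (k := k) u, ← mem_canonFilt hk, ← hact, hu,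
        ← Submodule.Quotient.mk_smul, Submodule.Quotient.mk_eq_zero]
      rfl

end Canonical

section Injective

variable {p : Quiver.Path a b} {k k' : DetourVar p → K}

/-- Only the trivial right subpath ends at `a`, so the `a`-component of the module is
one-dimensional and an isomorphism maps the canonical generator to a multiple of the canonical
generator. Both then satisfy the same relations, which determine the parameters. -/
theorem Phi_injOn (hp : ∀ u : RightSubpath p a, u.1.length = 0) :
    Set.InjOn (Phi I p) (pathVariety I p) := by
  intro k hk k' hk' h
  obtain ⟨ψ⟩ := Quotient.exact h
  let φ : ((PathAlgebra K Γ ⧸ I) ⧸ defIdeal I p k) ≃ₗ[PathAlgebra K Γ ⧸ I]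
    ((PathAlgebra K Γ ⧸ I) ⧸ defIdeal I p k') := ψ.toLinearEquiv
  obtain ⟨s, hs⟩ := Submodule.mkQ_surjective _ (φ ((defIdeal I p k).mkQ 1))
  obtain ⟨z, rfl⟩ := Ideal.Quotient.mk_surjective s
  have hgen : (defIdeal I p k).mkQ (Ideal.Quotient.mk I (vertexIdem K a)) =
      (defIdeal I p k).mkQ 1 := by
    rw [← map_one (Ideal.Quotient.mk I), eq_comm, ← sub_eq_zero, ← map_sub, ← map_sub]
    exact (Submodule.Quotient.mk_eq_zero _).2
      ((mk_mem_defIdeal hk).2 (mem_redKer.1 one_sub_mem_redKer))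
  obtain ⟨c, hc⟩ : ∃ c : K, red p k' (vertexIdem K a * z) = c • topComb K p := by
    refine ⟨red p k' (vertexIdem K a * z) a (RightSubpath.trivial p), ?_⟩
    funext y v
    rw [red_mul, vertexIdem]
    by_cases hy : y = a
    · subst hy
      have : v = RightSubpath.trivial p := RightSubpath.eq_of_length (hp v)
      rw [this, Pi.smul_apply, Pi.smul_apply, topComb, if_pos (by rfl), smul_eq_mul, mul_one]
    · rw [rep_ofPath_ne _ _ _ _ hy, Pi.smul_apply, topComb_ne p hy, smul_zero]
  have hφ : φ ((defIdeal I p k).mkQ 1) =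
      (defIdeal I p k').mkQ (Ideal.Quotient.mk I (c • 1)) := by
    rw [← hgen, ← mul_one (Ideal.Quotient.mk I (vertexIdem K a)), ← smul_eq_mul, map_smul,
      map_smul, ← hs, ← map_smul, smul_eq_mul, ← map_mul, ← sub_eq_zero, ← map_sub, ← map_sub]
    refine (Submodule.Quotient.mk_eq_zero _).2 ((mk_mem_defIdeal hk').2 ?_)
    rw [map_sub, hc, map_smul, red_one, sub_self]
  have hmem : ∀ w : PathAlgebra K Γ, w ∈ redKer p k → c • w ∈ redKer p k' := by
    intro w hw
    rw [mem_redKer, ← mk_mem_defIdeal hk] at hw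
    rw [mem_redKer, ← mk_mem_defIdeal hk', ← Submodule.Quotient.mk_eq_zero, ← mul_one w,
      ← mul_smul_comm, map_mul, ← smul_eq_mul, Submodule.Quotient.mk_smul]
    change _ • (defIdeal I p k').mkQ (Ideal.Quotient.mk I (c • 1)) = 0
    rw [← hφ, ← map_smul, ← map_smul, smul_eq_mul, mul_one, Submodule.mkQ_apply,
      (Submodule.Quotient.mk_eq_zero _).2 hw, map_zero]
  have hc0 : c ≠ 0 := by
    rintro rfl
    have h0 : φ ((defIdeal I p k).mkQ 1) = 0 := by
      rw [hφ, zero_smul, map_zero, map_zero]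
    rw [EmbeddingLike.map_eq_zero_iff, ← map_one (Ideal.Quotient.mk I), Submodule.mkQ_apply,
      Submodule.Quotient.mk_eq_zero, mk_mem_defIdeal hk, red_one] at h0
    have := congrFun (congrFun h0 a) (RightSubpath.trivial p)
    rw [topComb, if_pos (by rfl)] at this
    exact one_ne_zero this
  funext δ
  classical
  have h₁ := mem_ideal_of_smul hc0 (hmem _ (relation_mem_redKer δ.α δ.u))
  -- The relations with parameters `k` and `k'` both hold for `k'`; their difference is a normal
  -- form, hence zero coefficientwise.
  have h₂ := (redKer p k').sub_mem (relation_mem_redKer (k := k') δ.α δ.u) h₁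
  rw [sub_sub_sub_cancel_left, ← nf_single, ← nf_single, ← map_sub, mem_redKer, red_nf,
    ← Pi.single_sub] at h₂
  have h₃ := congrFun (congrFun h₂ δ.y) δ.v
  rw [Pi.single_eq_same, Pi.sub_apply, substCoeff_detour, substCoeff_detour] at h₃
  exact sub_eq_zero.1 h₃

end Injective

end Modules
-- Every uniserial module with the given series comes from a point.
section Surjective

variable {K : Type u} [Field K] {Γ : Type} [Quiver.{0} Γ] [Fintype Γ] {a b : Γ}
variable {I : Ideal (PathAlgebra K Γ)} [I.IsTwoSided]

/-- What a composition series with factors at the vertices `e 0, …, e l` says in elementary terms. -/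
structure IsVertexFiltration {U : Type*} [AddCommGroup U] [Module (PathAlgebra K Γ ⧸ I) U]
    {l : ℕ} (e : Fin (l + 1) → Γ) (G : ℕ → Submodule (PathAlgebra K Γ ⧸ I) U) : Prop where
  zero : G 0 = ⊤
  last : G (l + 1) = ⊥
  le (i : Fin (l + 1)) : G (i + 1) ≤ G i
  act_mem (i : Fin (l + 1)) (z : PathAlgebra K Γ)
    (hz : coeff z (Quiver.Path.nil : Quiver.Path (e i) (e i)) = 0) {f : U} (hf : f ∈ G i) :
    Ideal.Quotient.mk I z • f ∈ G (i + 1)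
  exists_notMem (i : Fin (l + 1)) : ∃ f ∈ G i, f ∉ G (i + 1)
  exists_sub_mem (i : Fin (l + 1)) {f g : U} (hf : f ∈ G i) (hf' : f ∉ G (i + 1)) (hg : g ∈ G i) :
    ∃ c : K, g - Ideal.Quotient.mk I (c • 1) • f ∈ G (i + 1)

theorem exists_isVertexFiltration (hI : IsAdmissible I) {U : Type u} [AddCommGroup U]
    [Module (PathAlgebra K Γ ⧸ I) U] {l : ℕ} {e : Fin (l + 1) → Γ}
    (hU : HasCompositionFactors (PathAlgebra K Γ ⧸ I) U fun i => simpleAt I (e i)) :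
    ∃ G : ℕ → Submodule (PathAlgebra K Γ ⧸ I) U, IsVertexFiltration e G := by
  obtain ⟨F, h0, hl, hF⟩ := hU
  -- Capping the index at `l + 1` turns the finite series into a sequence indexed by ℕ.
  let G : ℕ → Submodule (PathAlgebra K Γ ⧸ I) U := fun n => F ⟨min n (l + 1), by omega⟩
  have hG : ∀ i : Fin (l + 1), G i = F i.castSucc := fun i =>
    congrArg F (Fin.ext (by simp))
  have hG' : ∀ i : Fin (l + 1), G (i + 1) = F i.succ := fun i =>
    congrArg F (Fin.ext (by simp; omega))
  have hmem : ∀ (i : Fin (l + 1)) (f : U) (hf : f ∈ F i.castSucc)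
      (E : (F i.castSucc ⧸ (F i.succ).submoduleOf (F i.castSucc)) ≃ₗ[PathAlgebra K Γ ⧸ I]
        simpleAt I (e i)),
      E (Submodule.Quotient.mk ⟨f, hf⟩) = 0 ↔ f ∈ F i.succ := fun i f hf E => by
    rw [EmbeddingLike.map_eq_zero_iff, Submodule.Quotient.mk_eq_zero]
    rfl
  have hS : ∀ (c : Γ) (s : simpleAt I c), ∃ z : PathAlgebra K Γ,
      s = (Submodule.Quotient.mk (Ideal.Quotient.mk I z) :
        (PathAlgebra K Γ ⧸ I) ⧸ vertexIdeal I c) := fun c s => by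
    obtain ⟨r, rfl⟩ := Submodule.Quotient.mk_surjective (vertexIdeal I c) s
    obtain ⟨z, rfl⟩ := Ideal.Quotient.mk_surjective r
    exact ⟨z, rfl⟩
  refine ⟨G, ?_, ?_, fun i => ?_, fun i z hz f hf => ?_, fun i => ?_, fun i f g hf hf' hg => ?_⟩
  · rw [← h0]
    exact congrArg F (Fin.ext (by simp))
  · rw [← hl]
    exact congrArg F (Fin.ext (by simp))
  · rw [hG, hG']
    exact (hF i).1
  · rw [hG] at hf
    rw [hG']
    obtain ⟨E⟩ := (hF i).2
    obtain ⟨w, hw⟩ := hS (e i) (E (Submodule.Quotient.mk ⟨f, hf⟩))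
    rw [← hmem i _ ((F i.castSucc).smul_mem _ hf) E]
    have : E (Submodule.Quotient.mk (Ideal.Quotient.mk I z • ⟨f, hf⟩)) =
        (Submodule.Quotient.mk (Ideal.Quotient.mk I (z * w)) :
          (PathAlgebra K Γ ⧸ I) ⧸ vertexIdeal I (e i)) := by
      rw [Submodule.Quotient.mk_smul, map_smul, hw, map_mul]
      rfl
    refine Eq.trans this ((Submodule.Quotient.mk_eq_zero _).2 ((mk_mem_vertexIdeal hI).2 ?_))
    rw [coeff_mul_nil, hz, zero_mul]
  · rw [hG, hG']
    by_contra! h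
    obtain ⟨E⟩ := (hF i).2
    obtain ⟨_, s, hs⟩ := isSimpleAt_simpleAt hI (e i)
    obtain ⟨⟨⟨f, hf⟩, hf'⟩⟩ : Nonempty {t : F i.castSucc // E (Submodule.Quotient.mk t) = s} := by
      obtain ⟨t, ht⟩ := Submodule.Quotient.mk_surjective _ (E.symm s)
      exact ⟨t, by rw [ht, LinearEquiv.apply_symm_apply]⟩
    rw [← hf', (hmem i f hf E).2 (h f hf), smul_zero] at hs
    exact hs rfl
  · rw [hG] at hf hg
    rw [hG'] at hf'
    rw [hG']
    obtain ⟨E⟩ := (hF i).2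
    obtain ⟨w, hw⟩ := hS (e i) (E (Submodule.Quotient.mk ⟨f, hf⟩))
    obtain ⟨z, hz⟩ := hS (e i) (E (Submodule.Quotient.mk ⟨g, hg⟩))
    have hw0 : coeff w (Quiver.Path.nil : Quiver.Path (e i) (e i)) ≠ 0 := by
      intro h0
      refine hf' ((hmem i f hf E).1 (hw.trans ?_))
      exact (Submodule.Quotient.mk_eq_zero _).2 ((mk_mem_vertexIdeal hI).2 h0)
    set c := coeff z (Quiver.Path.nil : Quiver.Path (e i) (e i)) /
      coeff w (Quiver.Path.nil : Quiver.Path (e i) (e i)) with hc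
    refine ⟨c, ?_⟩
    rw [← hmem i _ ((F i.castSucc).sub_mem hg ((F i.castSucc).smul_mem _ hf)) E]
    have : E (Submodule.Quotient.mk (⟨g, hg⟩ - Ideal.Quotient.mk I (c • 1) • ⟨f, hf⟩)) =
        (Submodule.Quotient.mk (Ideal.Quotient.mk I (z - (c • 1) * w)) :
          (PathAlgebra K Γ ⧸ I) ⧸ vertexIdeal I (e i)) := by
      rw [Submodule.Quotient.mk_sub, Submodule.Quotient.mk_smul, map_sub, map_smul, hw, hz,
        map_sub, map_mul]
      rfl
    refine Eq.trans this ((Submodule.Quotient.mk_eq_zero _).2 ((mk_mem_vertexIdeal hI).2 ?_))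
    rw [smul_mul_assoc, one_mul, coeff_sub, coeff_smul, hc, div_mul_cancel₀ _ hw0, sub_self]

variable {U : Type u} [AddCommGroup U] [Module (PathAlgebra K Γ ⧸ I) U] {l : ℕ}
  {e : Fin (l + 1) → Γ} {G : ℕ → Submodule (PathAlgebra K Γ ⧸ I) U} {p : Quiver.Path a b}

/-- In a uniserial module over a path algebra without double arrows, the arrow between consecutive
composition factors leads from each layer onto the next. -/
theorem arrow_notMem (hG : IsVertexFiltration e G) (hU : IsUniserial (PathAlgebra K Γ ⧸ I) U)
    (hΓ : ∀ x y : Γ, Subsingleton (x ⟶ y)) {i₀ i₁ : Fin (l + 1)} {i : ℕ} (hi₀ : (i₀ : ℕ) = i)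
    (hi₁ : (i₁ : ℕ) = i + 1) (β : e i₀ ⟶ e i₁) {f : U} (hf : f ∈ G i) (hf' : f ∉ G (i + 1))
    (hidem : Ideal.Quotient.mk I (vertexIdem K (e i₀)) • f = f) :
    Ideal.Quotient.mk I (ofPath K β.toPath) • f ∉ G (i + 1 + 1) := by
  intro hβ
  subst hi₀
  have hG₁ := hG.act_mem i₁
  have hle₁ := hG.le i₁
  have hex₁ := hG.exists_notMem i₁
  rw [hi₁] at hG₁ hle₁ hex₁
  set i : ℕ := (i₀ : ℕ)
  have harrow : ∀ {y : Γ} (α : e i₀ ⟶ y),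
      Ideal.Quotient.mk I (ofPath K α.toPath) • f ∈ G (i + 1 + 1) := by
    intro y α
    by_cases hy : y = e i₁
    · subst hy
      rwa [(hΓ _ _).elim α β]
    -- `α f` is fixed by the idempotent at `y`, which annihilates the layer at the different vertex
    -- `e i₁`.
    · have h₁ : Ideal.Quotient.mk I (ofPath K α.toPath) • f ∈ G (i + 1) :=
        hG.act_mem i₀ _ (coeff_ofPath_of_length_ne (r := α.toPath) (by simp)) hf
      have h₂ := hG₁ _ (coeff_vertexIdem_ne hy) h₁
      rwa [← mul_smul, ← map_mul, vertexIdem, ofPath_mul_ofPath_same, Quiver.Path.comp_nil] at h₂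
  have hpath : ∀ {y : Γ} (q : Quiver.Path (e i₀) y), 0 < q.length →
      ofPath K q ∈ actIdeal (G (i + 1 + 1)) f := by
    intro y q
    induction q with
    | nil => simp
    | cons q α ih =>
      intro _
      cases q with
      | nil => exact harrow α
      | cons q' α' =>
        have := (actIdeal (G (i + 1 + 1)) f).mul_mem_left (ofPath K α.toPath)
          (ih (by simp))
        rwa [ofPath_mul_ofPath_same] at this
  have hall : ∀ w : PathAlgebra K Γ,
      w - coeff w (Quiver.Path.nil : Quiver.Path (e i₀) (e i₀)) • 1 ∈
        actIdeal (G (i + 1 + 1)) f := by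
    have hstart : ∀ w : PathAlgebra K Γ, w * vertexIdem K (e i₀) ∈ actIdeal (G (i + 1 + 1)) f →
        w ∈ actIdeal (G (i + 1 + 1)) f := fun w hw => by
      rwa [mem_actIdeal, map_mul, mul_smul, hidem] at hw
    intro w
    refine mem_of_forall_ofPath (N := ((actIdeal (G (i + 1 + 1)) f).restrictScalars K).comap
      (LinearMap.id - ((pathBasis K Γ).coord ⟨e i₀, e i₀, Quiver.Path.nil⟩).smulRight 1))
      (fun c d q => ?_) w
    change ofPath K q - coeff (ofPath K q) (Quiver.Path.nil : Quiver.Path (e i₀) (e i₀)) • 1 ∈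
      actIdeal (G (i + 1 + 1)) f
    by_cases hc : c = e i₀
    · subst hc
      cases q with
      | nil =>
        rw [coeff_ofPath_self, one_smul]
        refine hstart _ ?_
        rw [sub_mul, one_mul, vertexIdem, ofPath_mul_ofPath_same, Quiver.Path.nil_comp, sub_self]
        exact Ideal.zero_mem _
      | cons q α =>
        rw [coeff_ofPath_of_length_ne (r := q.cons α) (by simp), zero_smul, sub_zero]
        exact hpath _ (by simp)
    · rw [coeff_ofPath_ne, zero_smul, sub_zero]
      · refine hstart _ ?_
        rw [vertexIdem, ofPath_mul_ofPath_ne _ _ (Ne.symm hc)]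
        exact Ideal.zero_mem _
      · intro h
        exact hc (congrArg (fun s : Σ a b : Γ, Quiver.Path a b => s.1) h)
  have hle₀ : G (i + 1) ≤ G i := hG.le i₀
  -- All paths of positive length starting at `e i₀` send `f` into `G (i + 2)`, so `K f + G (i + 2)`
  -- is a submodule. It is incomparable with `G (i + 1)`, contradicting uniseriality.
  let N : Submodule (PathAlgebra K Γ ⧸ I) U :=
    { carrier := {g | ∃ c : K, g - Ideal.Quotient.mk I (c • 1) • f ∈ G (i + 1 + 1)}
      add_mem' := by
        rintro g g' ⟨c, hc⟩ ⟨c', hc'⟩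
        refine ⟨c + c', ?_⟩
        have := (G (i + 1 + 1)).add_mem hc hc'
        rwa [sub_add_sub_comm, ← add_smul, ← map_add, ← add_smul] at this
      zero_mem' := ⟨0, by simp⟩
      smul_mem' := by
        rintro r g ⟨c, hc⟩
        obtain ⟨w, rfl⟩ := Ideal.Quotient.mk_surjective r
        refine ⟨c * coeff w (Quiver.Path.nil : Quiver.Path (e i₀) (e i₀)), ?_⟩
        have h₁ := (G (i + 1 + 1)).smul_mem (Ideal.Quotient.mk I w) hc
        have h₂ := smul_mem_ideal c (hall w)
        rw [mem_actIdeal, smul_sub, map_sub, sub_smul, smul_smul] at h₂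
        rw [smul_sub, ← mul_smul, ← map_mul, mul_smul_comm, mul_one] at h₁
        have := (G (i + 1 + 1)).add_mem h₁ h₂
        rwa [sub_add_sub_cancel] at this }
  rcases hU N (G (i + 1)) with h | h
  · exact hf' (h (x := f) ⟨1, by simp⟩)
  · obtain ⟨g, hg, hg'⟩ := hex₁
    obtain ⟨c, hc⟩ := h hg
    by_cases hc0 : c = 0
    · rw [hc0, zero_smul, map_zero, zero_smul, sub_zero] at hc
      exact hg' hc
    · have h₁ := (G (i + 1)).sub_mem hg (hle₁ hc)
      rw [sub_sub_cancel] at h₁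
      have h₂ : (1 : PathAlgebra K Γ) ∈ actIdeal (G (i + 1)) f :=
        mem_ideal_of_smul hc0 h₁
      rw [mem_actIdeal, map_one, one_smul] at h₂
      exact hf' h₂

variable (hp : p.length = l) (he : ∀ (y : Γ) (u : RightSubpath p y) (i : Fin (l + 1)),
  u.1.length = i → y = e i)

include hp he

/-- Induction along `p`, with `arrow_notMem` for each arrow: `u x` represents a generator of the
layer numbered by the length of `u`. -/
theorem rightSubpath_mem (hG : IsVertexFiltration e G)
    (hU : IsUniserial (PathAlgebra K Γ ⧸ I) U) (hΓ : ∀ x y : Γ, Subsingleton (x ⟶ y)) {x : U}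
    (hx : x ∉ G 1) (hidem : Ideal.Quotient.mk I (vertexIdem K a) • x = x) {y : Γ}
    (u : RightSubpath p y) :
    ofPath K u.1 ∈ actIdeal (G u.1.length) x ∧ ofPath K u.1 ∉ actIdeal (G (u.1.length + 1)) x := by
  suffices ∀ {y : Γ} (q : Quiver.Path a y), IsRightSubpath p q →
      ofPath K q ∈ actIdeal (G q.length) x ∧ ofPath K q ∉ actIdeal (G (q.length + 1)) x from
    this u.1 u.2
  intro y q
  induction q with
  | nil =>
    intro _
    rw [mem_actIdeal, mem_actIdeal]
    change Ideal.Quotient.mk I (vertexIdem K a) • x ∈ _ ∧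
      Ideal.Quotient.mk I (vertexIdem K a) • x ∉ _
    rw [hidem, Quiver.Path.length_nil, hG.zero]
    exact ⟨trivial, hx⟩
  | @cons y y' q β ih =>
    intro hq
    have hq' := IsRightSubpath.of_cons hq
    obtain ⟨h₁, h₂⟩ := ih hq'
    have hl := hq.length_le
    rw [Quiver.Path.length_cons, hp] at hl
    obtain ⟨i₀, hi₀⟩ : ∃ i : Fin (l + 1), (i : ℕ) = q.length := ⟨⟨q.length, by omega⟩, rfl⟩
    obtain ⟨i₁, hi₁⟩ : ∃ i : Fin (l + 1), (i : ℕ) = q.length + 1 :=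
      ⟨⟨q.length + 1, by omega⟩, rfl⟩
    obtain rfl : y = e i₀ := he y ⟨q, hq'⟩ i₀ hi₀.symm
    obtain rfl : y' = e i₁ := he y' ⟨q.cons β, hq⟩ i₁ hi₁.symm
    have hact := hG.act_mem i₀
    rw [hi₀] at hact
    have e₁ : ofPath K (q.cons β) = ofPath K β.toPath * ofPath K q :=
      (ofPath_mul_ofPath_same β.toPath q).symm
    rw [e₁, mem_actIdeal, mem_actIdeal, map_mul, mul_smul, Quiver.Path.length_cons]
    refine ⟨hact _ (coeff_ofPath_of_length_ne (r := β.toPath) (by simp)) h₁,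
      arrow_notMem hG hU hΓ hi₀ hi₁ β h₁ h₂ ?_⟩
    rw [← mul_smul, ← map_mul, vertexIdem, ofPath_mul_ofPath_same, Quiver.Path.comp_nil]

omit he in
theorem nf_mem_actIdeal (hG : IsVertexFiltration e G) {x : U}
    (hmem : ∀ (y : Γ) (u : RightSubpath p y), ofPath K u.1 ∈ actIdeal (G u.1.length) x)
    {i : ℕ} {c : Comb K p} (hc : ∀ y v, v.1.length < i → c y v = 0) :
    nf p c ∈ actIdeal (G i) x := by
  have hanti : ∀ {i j : ℕ}, i ≤ j → j ≤ l + 1 → G j ≤ G i := by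
    intro i j hij
    induction j, hij using Nat.le_induction with
    | base => exact fun _ => le_rfl
    | succ j _ ih => exact fun hj => (hG.le ⟨j, by omega⟩).trans (ih (by omega))
  rw [nf_apply]
  refine Ideal.sum_mem _ fun y _ => Ideal.sum_mem _ fun v _ => ?_
  by_cases hv : v.1.length < i
  · rw [hc y v hv, zero_smul]
    exact Ideal.zero_mem _
  · have := v.2.length_le
    exact smul_mem_ideal _ (hanti (not_lt.1 hv) (by omega) (hmem y v))

omit he in
-- Layers are peeled off one at a time: each is spanned by the class of `u x` for the right subpath
-- `u` of that length.
theorem exists_comb (hG : IsVertexFiltration e G) {x : U}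
    (hmem : ∀ (y : Γ) (u : RightSubpath p y), ofPath K u.1 ∈ actIdeal (G u.1.length) x ∧
      ofPath K u.1 ∉ actIdeal (G (u.1.length + 1)) x)
    {i : ℕ} (hi : i ≤ l + 1) {f : U} (hf : f ∈ G i) :
    ∃ c : Comb K p, (∀ y v, v.1.length < i → c y v = 0) ∧
      f = Ideal.Quotient.mk I (nf p c) • x := by
  induction n : l + 1 - i generalizing i f with
  | zero =>
    obtain rfl : i = l + 1 := by omega
    rw [hG.last, Submodule.mem_bot] at hf
    exact ⟨0, fun _ _ _ => rfl, by simp [hf]⟩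
  | succ n ih =>
    obtain ⟨y, u, hu⟩ := exists_rightSubpath_length p (i := i) (by omega)
    subst hu
    obtain ⟨h₁, h₂⟩ := hmem y u
    obtain ⟨c₀, hc₀⟩ := hG.exists_sub_mem ⟨u.1.length, by omega⟩ h₁ h₂ hf
    obtain ⟨c, hc, hc'⟩ := ih (i := u.1.length + 1) (by omega) hc₀ (by omega)
    refine ⟨c + c₀ • unitComb K u, fun z v hv => ?_, ?_⟩
    · have hz : unitComb K u z v = 0 := by
        have := ofPath_mem_filtIdeal (k := fun _ => (0 : K)) u z v hv
        rwa [red_rightSubpath] at this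
      rw [Pi.add_apply, Pi.add_apply, hc z v (by omega), Pi.smul_apply, Pi.smul_apply, hz,
        smul_zero, add_zero]
    · rw [map_add, map_smul, nf_unitComb, map_add, add_smul, ← hc', ← mul_smul, ← map_mul,
        smul_mul_assoc, one_mul, sub_add_cancel]

omit he in
-- In a nontrivial relation, the shortest right subpath would send `x` one layer deeper than `hmem`
-- permits. Only normal forms are reduced, so any parameters would do for `red`; zero is used.
theorem comb_eq_zero (hG : IsVertexFiltration e G) {x : U}
    (hmem : ∀ (y : Γ) (u : RightSubpath p y), ofPath K u.1 ∈ actIdeal (G u.1.length) x ∧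
      ofPath K u.1 ∉ actIdeal (G (u.1.length + 1)) x)
    {c : Comb K p} (hc : Ideal.Quotient.mk I (nf p c) • x = 0) : c = 0 := by
  by_contra hne
  obtain ⟨y, u, hu, hu'⟩ := exists_leading (p := p) (k := fun _ => (0 : K)) (z := nf p c)
    (by rwa [red_nf])
  have h₁ := sub_smul_mem_filtIdeal u hu (ofPath_mem_filtIdeal u)
    (by rw [red_ofPath_self]; exact one_ne_zero)
  rw [red_ofPath_self, div_one] at h₁
  set c₀ := red p (fun _ => (0 : K)) (nf p c) y u
  have h₂ : nf p (c - c₀ • unitComb K u) ∈ actIdeal (G (u.1.length + 1)) x := by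
    refine nf_mem_actIdeal hp hG (fun y u => (hmem y u).1) fun z v hv => ?_
    have := h₁ z v hv
    rwa [map_sub, map_smul, red_nf, red_rightSubpath] at this
  have h₃ : nf p c ∈ actIdeal (G (u.1.length + 1)) x := by
    rw [mem_actIdeal, hc]
    exact Submodule.zero_mem _
  have h₄ := Ideal.sub_mem _ h₃ h₂
  rw [← map_sub, sub_sub_cancel, map_smul, nf_unitComb] at h₄
  exact (hmem y u).2 (mem_ideal_of_smul hu' h₄)

/-- Every uniserial module whose composition series follows `p` belongs to a point of the variety
of `p`. -/
theorem exists_point (hG : IsVertexFiltration e G)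
    (hU : IsUniserial (PathAlgebra K Γ ⧸ I) U) (hΓ : ∀ x y : Γ, Subsingleton (x ⟶ y)) :
    ∃ k ∈ pathVariety I p,
      Nonempty (((PathAlgebra K Γ ⧸ I) ⧸ defIdeal I p k) ≃ₗ[PathAlgebra K Γ ⧸ I] U) := by
  classical
  have ha : a = e 0 := he a (RightSubpath.trivial p) 0 rfl
  obtain ⟨x₀, hx₀, hx₀'⟩ := hG.exists_notMem 0
  set x := Ideal.Quotient.mk I (vertexIdem K a) • x₀ with hx
  have hidem : Ideal.Quotient.mk I (vertexIdem K a) • x = x := by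
    rw [hx, ← mul_smul, ← map_mul, vertexIdem, ofPath_mul_ofPath_same, Quiver.Path.comp_nil]
  have hx1 : x ∉ G 1 := by
    intro h
    have h' := hG.act_mem 0 (1 - vertexIdem K a) (by
      subst ha
      rw [coeff_sub, coeff_one_nil, coeff_vertexIdem_self, sub_self]) hx₀
    rw [map_sub, map_one, sub_smul, one_smul, ← hx] at h'
    have := (G 1).add_mem h' h
    rw [sub_add_cancel] at this
    exact hx₀' this
  have hmem : ∀ (y : Γ) (u : RightSubpath p y), ofPath K u.1 ∈ actIdeal (G u.1.length) x ∧
      ofPath K u.1 ∉ actIdeal (G (u.1.length + 1)) x :=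
    fun y u => rightSubpath_mem hp he hG hU hΓ hx1 hidem u
  -- `α u x` lies one layer deeper than `u x`, so it expands in longer right subpaths; the
  -- idempotent at `y'` keeps those ending there. These coefficients will be the point `k`.
  have hex : ∀ (y y' : Γ) (α : y ⟶ y') (u : RightSubpath p y), ∃ c : RightSubpath p y' → K,
      (∀ v, v.1.length ≤ u.1.length → c v = 0) ∧
      ofPath K (u.1.cons α) - ∑ v, c v • ofPath K v.1 ∈ actIdeal (⊥ : Submodule (PathAlgebra K Γ ⧸ I) U) x := by
    intro y y' α u
    have hul := u.2.length_le
    obtain ⟨i, hi⟩ : ∃ i : Fin (l + 1), (i : ℕ) = u.1.length := ⟨⟨u.1.length, by omega⟩, rfl⟩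
    obtain rfl : y = e i := he y u i hi.symm
    have hact := hG.act_mem i
    rw [hi] at hact
    have h₁ := hact _ (coeff_ofPath_of_length_ne (r := α.toPath) (by simp)) (hmem _ u).1
    obtain ⟨c, hc, hc'⟩ := exists_comb hp hG hmem (i := u.1.length + 1) (by omega) h₁
    refine ⟨c y', fun v hv => hc y' v (by omega), ?_⟩
    have h₂ : vertexIdem K y' * nf p c = ∑ v, c y' v • ofPath K v.1 := by
      rw [nf_apply, Finset.mul_sum, Finset.sum_eq_single y']
      · simp only [Finset.mul_sum, mul_smul_comm, vertexIdem, ofPath_mul_ofPath_same,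
          Quiver.Path.comp_nil]
      · intro z _ hz
        rw [Finset.mul_sum]
        refine Finset.sum_eq_zero fun v _ => ?_
        rw [mul_smul_comm, vertexIdem, ofPath_mul_ofPath_ne _ _ hz, smul_zero]
      · simp
    have h₃ : vertexIdem K y' * (ofPath K α.toPath * ofPath K u.1) = ofPath K (u.1.cons α) := by
      rw [ofPath_mul_ofPath_same, vertexIdem, ofPath_mul_ofPath_same]
      rfl
    rw [← h₂, ← h₃, ← mul_sub]
    refine Ideal.mul_mem_left _ _ ?_
    rw [mem_actIdeal, Submodule.mem_bot, map_sub, sub_smul, ← hc', map_mul, mul_smul, sub_self]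
  choose C hC hC' using hex
  let k : DetourVar p → K := fun δ => C δ.x δ.y δ.α δ.u δ.v
  have hrel : ∀ (y y' : Γ) (α : y ⟶ y') (u : RightSubpath p y),
      ofPath K (u.1.cons α) - ∑ v, substCoeff p k α u v • ofPath K v.1 ∈ actIdeal (⊥ : Submodule (PathAlgebra K Γ ⧸ I) U) x := by
    intro y y' α u
    by_cases hr : IsRightSubpath p (u.1.cons α)
    · let v₀ : RightSubpath p y' := ⟨u.1.cons α, hr⟩
      rw [Finset.sum_eq_single v₀, substCoeff_eq_one (v := v₀) rfl, one_smul]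
      · change ofPath K (u.1.cons α) - ofPath K (u.1.cons α) ∈ _
        rw [sub_self]
        exact Ideal.zero_mem _
      · intro v _ hv
        rw [substCoeff_of_ne hr fun h => hv (Subtype.ext h), zero_smul]
      · simp
    · have : ∀ v, substCoeff p k α u v = C y y' α u v := fun v => by
        rw [substCoeff, dif_neg hr]
        split_ifs with h
        · rfl
        · exact (hC y y' α u v (not_lt.1 h)).symm
      simp only [this]
      exact hC' y y' α u
  have hone : 1 - vertexIdem K a ∈ actIdeal (⊥ : Submodule (PathAlgebra K Γ ⧸ I) U) x := by
    rw [mem_actIdeal, map_sub, map_one, sub_smul, one_smul, hidem, sub_self]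
    exact Submodule.zero_mem _
  have hnf : ∀ z : PathAlgebra K Γ,
      Ideal.Quotient.mk I z • x = Ideal.Quotient.mk I (nf p (red p k z)) • x := fun z => by
    have := sub_nf_mem hone hrel z
    rwa [mem_actIdeal, map_sub, sub_smul, Submodule.mem_bot, sub_eq_zero] at this
  -- The annihilator of `x` is the kernel of the substitution; this yields both `k ∈ V_p` and the
  -- isomorphism.
  have hzero : ∀ z : PathAlgebra K Γ, Ideal.Quotient.mk I z • x = 0 ↔ red p k z = 0 := fun z => by
    rw [hnf]
    refine ⟨comb_eq_zero hp hG hmem, fun h => ?_⟩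
    rw [h, map_zero, map_zero, zero_smul]
  have hk : k ∈ pathVariety I p := by
    rw [mem_pathVariety]
    intro z hz
    rw [← hzero, Ideal.Quotient.eq_zero_iff_mem.2 hz, zero_smul]
  refine ⟨k, hk, nonempty_quotient_equiv (t := x) (fun f => ?_) fun r => ?_⟩
  · obtain ⟨c, -, hc⟩ := exists_comb hp hG hmem (i := 0) (by omega) (f := f)
      (by rw [hG.zero]; trivial)
    exact ⟨_, hc.symm⟩
  · obtain ⟨z, rfl⟩ := Ideal.Quotient.mk_surjective r
    rw [hzero, mk_mem_defIdeal hk]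

omit hp he

omit [Fintype Γ] in
theorem exists_rightSubpath_of_vertices {l : ℕ} {e : Fin (l + 1) → Γ}
    {p : Quiver.Path (e 0) (e (Fin.last l))} (hp : p.vertices = List.ofFn e) :
    p.length = l ∧ (∀ (y : Γ) (u : RightSubpath p y) (i : Fin (l + 1)), u.1.length = i → y = e i) ∧
      ∀ i, ∃ u : RightSubpath p (e i), u.1.length = i := by
  have hl : p.length = l := by
    have := congrArg List.length hp
    rw [Quiver.Path.vertices_length, List.length_ofFn] at this
    omega
  have he : ∀ (y : Γ) (u : RightSubpath p y) (i : Fin (l + 1)), u.1.length = i → y = e i := by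
    rintro y ⟨u, w, rfl⟩ i hi
    have h := congrArg (fun L : List Γ => L[(i : ℕ)]?) hp
    simp only at hi
    rw [Quiver.Path.vertices_comp, List.getElem?_append_right (by simp [hi]), List.getElem?_ofFn,
      dif_pos i.2] at h
    simpa [hi] using h
  refine ⟨hl, he, fun i => ?_⟩
  obtain ⟨y, u, hu⟩ := exists_rightSubpath_length p (i := i) (by omega)
  obtain rfl := he y u i hu
  exact ⟨u, hu⟩

/-- If `p` visits its starting vertex only once, and there are no double arrows, then the points of
the variety of `p` classify the uniserial modules with the composition series given by `p`. -/
theorem Phi_bijOn (hI : IsAdmissible I) (hΓ : ∀ x y : Γ, Subsingleton (x ⟶ y)) {l : ℕ}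
    {e : Fin (l + 1) → Γ} {p : Quiver.Path (e 0) (e (Fin.last l))}
    (hp : p.vertices = List.ofFn e) (h0 : ∀ i, e i = e 0 → i = 0) :
    Set.BijOn (Phi I p) (pathVariety I p)
      (uniserialTypes (PathAlgebra K Γ ⧸ I) fun i => simpleAt I (e i)) := by
  obtain ⟨hl, he, he'⟩ := exists_rightSubpath_of_vertices hp
  refine ⟨fun k hk => ⟨_, rfl, isUniserial_quotient hk,
    hasCompositionFactors_quotient hI hk hl e he'⟩, Phi_injOn fun u => ?_, ?_⟩
  · have hul := u.2.length_le
    have := h0 ⟨u.1.length, by omega⟩ (he _ u ⟨u.1.length, by omega⟩ rfl).symm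
    exact congrArg Fin.val this
  · rintro _ ⟨U, rfl, hU, hF⟩
    obtain ⟨G, hG⟩ := exists_isVertexFiltration hI hF
    obtain ⟨k, hk, ⟨E⟩⟩ := exists_point hl he hG hU hΓ
    exact ⟨k, hk, Quotient.sound ⟨E.toModuleIso⟩⟩

end Surjective
-- The largest ideal of relations compatible with a set of parameters.
section RelationIdeal

variable {K : Type u} [Field K] {Γ : Type} [Quiver.{0} Γ] {a b : Γ}

/-- The elements of the path algebra involving only paths of length at least `n`. -/
noncomputable def longSpan (K : Type u) [Field K] (Γ : Type) [Quiver.{0} Γ] (n : ℕ) :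
    Submodule K (PathAlgebra K Γ) :=
  Submodule.span K {z | ∃ (c d : Γ) (q : Quiver.Path c d), n ≤ q.length ∧ z = ofPath K q}

theorem mem_longSpan {n : ℕ} {z : PathAlgebra K Γ} :
    z ∈ longSpan K Γ n ↔ ∀ (c d : Γ) (q : Quiver.Path c d), coeff z q ≠ 0 → n ≤ q.length := by
  constructor
  · intro hz c d q
    contrapose!
    intro hq
    have : longSpan K Γ n ≤ LinearMap.ker ((pathBasis K Γ).coord ⟨c, d, q⟩) := by
      refine Submodule.span_le.2 ?_
      rintro _ ⟨c', d', r, hr, rfl⟩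
      exact coeff_ofPath_of_length_ne (by omega)
    exact this hz
  · intro h
    rw [← (pathBasis K Γ).linearCombination_repr z, Finsupp.linearCombination_apply]
    refine Submodule.sum_mem _ fun q hq => Submodule.smul_mem _ _ (Submodule.subset_span ?_)
    exact ⟨q.1, q.2.1, q.2.2, h _ _ _ (Finsupp.mem_support_iff.1 hq), rfl⟩

variable [Fintype Γ]

omit [Fintype Γ] in
theorem mul_mem_longSpan {n : ℕ} (w : PathAlgebra K Γ) {z : PathAlgebra K Γ}
    (hz : z ∈ longSpan K Γ n) : w * z ∈ longSpan K Γ n ∧ z * w ∈ longSpan K Γ n := by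
  constructor
  · refine mem_of_forall_ofPath (N := (longSpan K Γ n).comap ((mulHom K Γ).flip z))
      (fun c d r => ?_) w
    have : longSpan K Γ n ≤ (longSpan K Γ n).comap (mulHom K Γ (ofPath K r)) := by
      refine Submodule.span_le.2 ?_
      rintro _ ⟨c', d', q, hq, rfl⟩
      change ofPath K r * ofPath K q ∈ longSpan K Γ n
      by_cases h : d' = c
      · subst h
        rw [ofPath_mul_ofPath_same]
        exact Submodule.subset_span ⟨_, _, _, by rw [Quiver.Path.length_comp]; omega, rfl⟩
      · rw [ofPath_mul_ofPath_ne _ _ h]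
        exact Submodule.zero_mem _
    exact this hz
  · refine mem_of_forall_ofPath (N := (longSpan K Γ n).comap (mulHom K Γ z))
      (fun c d r => ?_) w
    have : longSpan K Γ n ≤ (longSpan K Γ n).comap ((mulHom K Γ).flip (ofPath K r)) := by
      refine Submodule.span_le.2 ?_
      rintro _ ⟨c', d', q, hq, rfl⟩
      change ofPath K q * ofPath K r ∈ longSpan K Γ n
      by_cases h : d = c'
      · subst h
        rw [ofPath_mul_ofPath_same]
        exact Submodule.subset_span ⟨_, _, _, by rw [Quiver.Path.length_comp]; omega, rfl⟩
      · rw [ofPath_mul_ofPath_ne _ _ h]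
        exact Submodule.zero_mem _
    exact this hz

/-- The elements of the square of the arrow ideal that annihilate the modules given by the
parameters in `W`. -/
noncomputable def relIdeal (p : Quiver.Path a b) (W : Set (DetourVar p → K)) :
    Ideal (PathAlgebra K Γ) where
  carrier := {z | z ∈ longSpan K Γ 2 ∧ ∀ r : PathAlgebra K Γ, ∀ k ∈ W, red p k (z * r) = 0}
  add_mem' := by
    rintro z w ⟨hz, hz'⟩ ⟨hw, hw'⟩
    refine ⟨Submodule.add_mem _ hz hw, fun r k hk => ?_⟩
    rw [add_mul, map_add, hz' r k hk, hw' r k hk, add_zero]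
  zero_mem' := ⟨Submodule.zero_mem _, fun r k _ => by rw [zero_mul, map_zero]⟩
  smul_mem' := by
    rintro w z ⟨hz, hz'⟩
    refine ⟨(mul_mem_longSpan w hz).1, fun r k hk => ?_⟩
    rw [smul_eq_mul, mul_assoc, red_mul, hz' r k hk, map_zero]

variable {p : Quiver.Path a b} {W : Set (DetourVar p → K)}

instance : (relIdeal p W).IsTwoSided where
  mul_mem_of_left := by
    rintro z w ⟨hz, hz'⟩
    refine ⟨(mul_mem_longSpan w hz).2, fun r k hk => ?_⟩
    rw [mul_assoc]
    exact hz' _ k hk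

theorem isAdmissible_relIdeal : IsAdmissible (relIdeal p W) := by
  -- Length `p.length + 1` suffices to annihilate the modules; one more ensures length at least 2
  -- even if `p` is trivial.
  refine ⟨fun z hz => mem_longSpan.1 hz.1, p.length + 2, fun c d q hq => ⟨?_, fun r k _ => ?_⟩⟩
  · exact Submodule.subset_span ⟨c, d, q, by omega, rfl⟩
  · rw [← mem_redKer]
    refine mem_of_forall_ofPath (N := ((redKer p k).restrictScalars K).comap
      (mulHom K Γ (ofPath K q))) (fun c' d' r => ?_) r
    change ofPath K q * ofPath K r ∈ redKer p k
    by_cases h : d' = c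
    · subst h
      rw [ofPath_mul_ofPath_same]
      refine filtIdeal_antitone ?_ (path_mem_filtIdeal _)
      rw [Quiver.Path.length_comp]
      omega
    · rw [ofPath_mul_ofPath_ne _ _ h]
      exact Ideal.zero_mem _

theorem subset_pathVariety_relIdeal : W ⊆ pathVariety (relIdeal p W) p := by
  intro k hk
  rw [mem_pathVariety]
  rintro z ⟨-, hz⟩
  have := hz 1 k hk
  rwa [mul_one] at this

/-- Relations between paths that start where `p` does, if no arrow ends there. -/
theorem mem_relIdeal_of_isSource (ha : ∀ c, (q : Quiver.Path c a) → q.length = 0)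
    {z : PathAlgebra K Γ} (hz : z ∈ longSpan K Γ 2) (hza : z * vertexIdem K a = z)
    (hW : ∀ k ∈ W, red p k z = 0) : z ∈ relIdeal p W := by
  refine ⟨hz, fun r k hk => ?_⟩
  rw [← mem_redKer]
  -- Among paths `r`, only the trivial one at `a` can give `z * r ≠ 0`, so annihilating the top
  -- element is enough.
  refine mem_of_forall_ofPath (N := ((redKer p k).restrictScalars K).comap
    (mulHom K Γ z)) (fun c d r => ?_) r
  change z * ofPath K r ∈ redKer p k
  by_cases h : d = a
  · subst h
    cases r with
    | nil =>
      change z * vertexIdem K _ ∈ redKer p k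
      rw [hza, mem_redKer, hW k hk]
    | cons r α =>
      have := ha c (r.cons α)
      rw [Quiver.Path.length_cons] at this
      omega
  · rw [← hza, mul_assoc, vertexIdem, ofPath_mul_ofPath_ne _ _ h, mul_zero]
    exact Ideal.zero_mem _

end RelationIdeal

/-! ### The loop chain, its mast and its detours. -/

/-- The vertices of a chain of arrows in which every second vertex carries a loop. -/
@[ext]
structure LoopChain (N : ℕ) : Type where
  /-- the position of the vertex -/
  val : ℕ
  lt : val < 2 * N + 1

namespace LoopChain

variable {N : ℕ}

instance : Fintype (LoopChain N) := Fintype.ofEquiv (Fin (2 * N + 1))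
  ⟨fun i => ⟨i.1, i.2⟩, fun x => ⟨x.1, x.2⟩, fun _ => rfl, fun _ => rfl⟩

instance : Quiver.{0} (LoopChain N) where
  Hom x y := PLift (y.1 = x.1 + 1 ∨ (y.1 = x.1 ∧ x.1 % 2 = 1))

instance (x y : LoopChain N) : Subsingleton (x ⟶ y) :=
  inferInstanceAs (Subsingleton (PLift _))

theorem arrow_iff {x y : LoopChain N} (α : x ⟶ y) :
    y.1 = x.1 + 1 ∨ (y.1 = x.1 ∧ x.1 % 2 = 1) := α.down

theorem path_le {x y : LoopChain N} (q : Quiver.Path x y) : x.1 ≤ y.1 := by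
  induction q with
  | nil => exact le_rfl
  | cons q α ih =>
    have := arrow_iff α
    omega

theorem cons_of_eq {x y y' : LoopChain N} (q : Quiver.Path x y') (β : y' ⟶ y) (α : x ⟶ y)
    (h : y'.1 = x.1) : ∃ c : Quiver.Path x x, q.cons β = c.cons α := by
  obtain rfl : y' = x := LoopChain.ext h
  exact ⟨q, by rw [Subsingleton.elim α β]⟩

/-- An even vertex has at most one outgoing arrow, so a path from it begins with `α`. At an odd
vertex, `α` is the loop, where the path must stay, or leads to the next vertex, which is even and
has no other incoming arrow; either way the path ends with `α`. -/
theorem conditionN {K : Type u} [Field K] (I : Ideal (PathAlgebra K (LoopChain N)))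
    [I.IsTwoSided] : ConditionN I := by
  intro x y α q hq _
  have hα := arrow_iff α
  by_cases hx : x.1 % 2 = 1
  · right
    cases q with
    | nil => simp at hq
    | cons q β =>
      have := path_le q
      have := arrow_iff β
      exact cons_of_eq q β α (by omega)
  · left
    obtain ⟨y', β, r, -, rfl⟩ := q.eq_toPath_comp_of_length_eq_succ (n := q.length - 1) (by omega)
    have := arrow_iff β
    obtain rfl : y' = y := LoopChain.ext (by omega)
    exact ⟨r, by rw [Subsingleton.elim α β]⟩

/-- The vertex reached after `t` steps by the walk that runs through every loop once. -/
def vtx (N t : ℕ) : LoopChain N := ⟨min ((2 * t + 1) / 3) (2 * N), by omega⟩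

/-- The positions are 0, 1, 1, 2, 3, 3, 4, …: steps `3i + 1` and `3i + 2` share the odd vertex `2i +
1`, with its loop between them. The cap in `vtx` only makes it total. -/
theorem val_vtx {t : ℕ} (ht : t ≤ 3 * N) : (vtx N t).1 = (2 * t + 1) / 3 := by
  simp only [vtx]
  omega

/-- The `t`-th arrow of the walk that runs through every loop once. -/
def arr {t : ℕ} (ht : t + 1 ≤ 3 * N) : vtx N t ⟶ vtx N (t + 1) :=
  ⟨by rw [val_vtx ht, val_vtx (t := t) (by omega)]; omega⟩

/-- The walk that runs through every loop once, up to step `t`. -/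
def walk : (t : ℕ) → t ≤ 3 * N → Quiver.Path (vtx N 0) (vtx N t)
  | 0, _ => Quiver.Path.nil
  | t + 1, h => (walk t (by omega)).cons (arr h)

theorem walk_length : ∀ (t : ℕ) (h : t ≤ 3 * N), (walk t h).length = t
  | 0, _ => rfl
  | t + 1, h => by rw [walk, Quiver.Path.length_cons, walk_length t]

theorem walk_vertices : ∀ (t : ℕ) (h : t ≤ 3 * N),
    (walk t h).vertices = List.ofFn fun i : Fin (t + 1) => vtx N i
  | 0, _ => rfl
  | t + 1, h => by
    rw [walk, Quiver.Path.vertices_cons, walk_vertices t, List.ofFn_succ' (n := t + 1)]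
    rfl

/-- The walk that runs through every loop once. -/
def mast (N : ℕ) : Quiver.Path (vtx N 0) (vtx N (3 * N)) := walk (3 * N) le_rfl

theorem mast_length : (mast N).length = 3 * N := walk_length _ _

theorem isRightSubpath_walk {t : ℕ} (h : t ≤ 3 * N) : IsRightSubpath (mast N) (walk t h) := by
  suffices ∀ (s : ℕ), t ≤ s → ∀ hs : s ≤ 3 * N, ∃ w, (walk t h).comp w = walk s hs from
    this (3 * N) h le_rfl
  intro s hts
  induction s, hts using Nat.le_induction with
  | base => exact fun _ => ⟨Quiver.Path.nil, rfl⟩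
  | succ s _ ih =>
    intro hs
    obtain ⟨w, hw⟩ := ih (by omega)
    exact ⟨w.cons (arr hs), by rw [Quiver.Path.comp_cons, hw, walk]⟩

/-- An initial segment of the mast. -/
def seg {t : ℕ} (h : t ≤ 3 * N) : RightSubpath (mast N) (vtx N t) :=
  ⟨walk t h, isRightSubpath_walk h⟩

theorem seg_length {t : ℕ} (h : t ≤ 3 * N) : (seg h).1.length = t := walk_length t h

theorem rightSubpath_cases {y : LoopChain N} (u : RightSubpath (mast N) y) :
    ∃ (t : ℕ) (h : t ≤ 3 * N), u.1.length = t ∧ y = vtx N t ∧ HEq u (seg h) := by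
  have hl := u.2.length_le
  rw [mast_length] at hl
  obtain ⟨w, hw⟩ := u.2.exists_comp (isRightSubpath_walk hl) (walk_length _ _).ge
  have hl' := congrArg Quiver.Path.length hw
  rw [Quiver.Path.length_comp, walk_length] at hl'
  have hy : y = vtx N u.1.length := Quiver.Path.eq_of_length_zero w (by omega)
  refine ⟨_, hl, rfl, hy, ?_⟩
  clear hl' hw w
  generalize ht : u.1.length = t at hl hy
  subst hy
  exact heq_of_eq (RightSubpath.eq_of_length (ht.trans (seg_length hl).symm))

/-- The arrow that leaves the `i`-th vertex with a loop. -/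
def exit {i : ℕ} (hi : i < N) : vtx N (3 * i + 1) ⟶ vtx N (3 * i + 3) :=
  ⟨by rw [val_vtx (by omega), val_vtx (by omega)]; omega⟩

/-- The variable belonging to the detour around the `i`-th loop. -/
def slot {i : ℕ} (hi : i < N) : DetourVar (mast N) where
  x := vtx N (3 * i + 1)
  y := vtx N (3 * i + 3)
  α := exit hi
  u := seg (by omega)
  v := seg (by omega)
  -- After step `3i + 1` the mast takes the loop, whereas `exit` already reaches `2i + 2`.
  not_right h := by
    obtain ⟨t, ht, h₁, h₂, -⟩ := rightSubpath_cases ⟨_, h⟩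
    simp only [Quiver.Path.length_cons] at h₁
    rw [seg_length] at h₁
    have := congrArg LoopChain.val h₂
    rw [val_vtx ht, val_vtx (by omega)] at this
    omega
  longer := by rw [seg_length, seg_length]; omega

theorem slot_injective {i j : ℕ} {hi : i < N} {hj : j < N} (h : slot hi = slot hj) : i = j := by
  have := congrArg (fun δ : DetourVar (mast N) => δ.u.1.length) h
  simp only [slot] at this
  rw [seg_length, seg_length] at this
  omega

/-- At an even vertex the only arrow is the mast's. After the loop, the way on is the mast's, and a
second loop ends where no longer right subpath does. This leaves `exit` at step `3i + 1`, and `2i +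
2` is visited at step `3i + 3` only. -/
theorem exists_slot (δ : DetourVar (mast N)) : ∃ (i : ℕ) (hi : i < N), δ = slot hi := by
  obtain ⟨x, y, α, u, v, hnot, hlong⟩ := δ
  obtain ⟨j, hj, hju, rfl, hu⟩ := rightSubpath_cases u
  obtain rfl := eq_of_heq hu
  by_cases h : y = vtx N (j + 1)
  · subst h
    have hj' := v.2.length_le
    rw [mast_length] at hj'
    rw [seg_length] at hlong
    rw [Subsingleton.elim α (arr (by omega))] at hnot
    exact absurd (isRightSubpath_walk (t := j + 1) (by omega)) hnot
  · obtain ⟨m, hm, hmv, rfl, hv⟩ := rightSubpath_cases v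
    obtain rfl := eq_of_heq hv
    rw [seg_length, seg_length] at hlong
    have hα := arrow_iff α
    have hne : (vtx N m).1 ≠ (vtx N (j + 1)).1 := fun h' => h (LoopChain.ext h')
    rw [val_vtx hm, val_vtx (by omega)] at hne
    rw [val_vtx hj, val_vtx hm] at hα
    obtain ⟨i, rfl⟩ : ∃ i, j = 3 * i + 1 := ⟨j / 3, by omega⟩
    obtain rfl : m = 3 * i + 3 := by omega
    refine ⟨i, by omega, ?_⟩
    obtain rfl := Subsingleton.elim α (exit (by omega))
    rfl

theorem path_source {c : LoopChain N} (q : Quiver.Path c (vtx N 0)) : q.length = 0 := by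
  cases q with
  | nil => rfl
  | cons q α =>
    have := arrow_iff α
    rw [val_vtx (by omega)] at this
    omega

open scoped Classical in
/-- The path that skips the loops with number in `A`, up to the `i`-th loop. -/
noncomputable def skip (A : Set ℕ) : (i : ℕ) → i ≤ N → Quiver.Path (vtx N 0) (vtx N (3 * i))
  | 0, _ => Quiver.Path.nil
  | i + 1, h =>
    if i ∈ A then ((skip A i (by omega)).cons (arr (by omega))).cons (exit h)
    else (((skip A i (by omega)).cons (arr (t := 3 * i) (by omega))).cons
      (arr (t := 3 * i + 1) (by omega))).cons (arr (t := 3 * i + 2) (by omega))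

theorem le_skip_length (A : Set ℕ) : ∀ (i : ℕ) (h : i ≤ N), 2 * i ≤ (skip A i h).length
  | 0, _ => by simp
  | i + 1, h => by
    have := le_skip_length A i (by omega)
    rw [skip]
    split_ifs
    · simp only [Quiver.Path.length_cons]
      omega
    · simp only [Quiver.Path.length_cons]
      omega

section Skip

variable {K : Type u} [Field K] (k : DetourVar (mast N) → K)

open scoped Classical in
theorem act_arr {t : ℕ} (ht : t + 1 ≤ 3 * N) {q : Quiver.Path (vtx N 0) (vtx N t)} {c : K}
    (hq : ∀ v, act (mast N) k q (topComb K (mast N) _) v =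
      if v = seg (by omega : t ≤ 3 * N) then c else 0) (v) :
    act (mast N) k (q.cons (arr ht)) (topComb K (mast N) _) v = if v = seg ht then c else 0 := by
  have ht' : t ≤ 3 * N := by omega
  rw [act_cons, Finset.sum_eq_single (seg ht')]
  · rw [hq, if_pos rfl]
    by_cases h : v = seg ht
    · rw [if_pos h, substCoeff_eq_one (by rw [h]; rfl), mul_one]
    · rw [if_neg h, substCoeff_of_ne (isRightSubpath_walk ht), mul_zero]
      exact fun h' => h (Subtype.ext h')
  · intro u _ hu
    rw [hq, if_neg hu, zero_mul]
  · simp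

open scoped Classical in
theorem act_exit {i : ℕ} (hi : i < N) {q : Quiver.Path (vtx N 0) (vtx N (3 * i + 1))} {c : K}
    (hq : ∀ v, act (mast N) k q (topComb K (mast N) _) v =
      if v = seg (by omega : 3 * i + 1 ≤ 3 * N) then c else 0) (v) :
    act (mast N) k (q.cons (exit hi)) (topComb K (mast N) _) v =
      if v = seg (by omega : 3 * i + 3 ≤ 3 * N) then c * k (slot hi) else 0 := by
  have h₁ : 3 * i + 1 ≤ 3 * N := by omega
  have h₃ : 3 * i + 3 ≤ 3 * N := by omega
  -- An even vertex is visited just once, so a single right subpath ends there.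
  have hv : v = seg h₃ := by
    obtain ⟨t, ht, hl, hy, -⟩ := rightSubpath_cases v
    refine RightSubpath.eq_of_length ?_
    have := congrArg LoopChain.val hy
    rw [val_vtx ht, val_vtx h₃] at this
    rw [seg_length, hl]
    omega
  subst hv
  rw [act_cons, Finset.sum_eq_single (seg h₁), if_pos rfl]
  · rw [hq, if_pos rfl]
    exact congrArg (c * ·) (substCoeff_detour (slot hi))
  · intro u _ hu
    rw [hq, if_neg hu, zero_mul]
  · simp

open scoped Classical in
-- Each skipped loop contributes its variable through `act_exit`; steps along the mast leave the
-- coefficient unchanged.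
theorem act_skip (A : Set ℕ) : ∀ (i : ℕ) (h : i ≤ N) (v),
    act (mast N) k (skip A i h) (topComb K (mast N) _) v =
      if v = seg (by omega : 3 * i ≤ 3 * N) then
        ∏ j ∈ Finset.range i, (if hj : j < N ∧ j ∈ A then k (slot hj.1) else 1) else 0
  | 0, h => fun v => by
    have : v = seg (by omega : 3 * 0 ≤ 3 * N) ↔ v.1.length = 0 :=
      ⟨fun h => by rw [h, seg_length], fun h => RightSubpath.eq_of_length (by rw [h, seg_length])⟩
    rw [Finset.prod_range_zero]
    exact if_congr this.symm rfl rfl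
  | i + 1, h => fun v => by
    have ih := act_skip A i (by omega)
    rw [skip, Finset.prod_range_succ]
    by_cases hA : i ∈ A
    · rw [if_pos hA, dif_pos ⟨h, hA⟩]
      exact act_exit k h (act_arr k (t := 3 * i) (by omega) ih) v
    · rw [if_neg hA, dif_neg fun h => hA h.2, mul_one]
      exact act_arr k (t := 3 * i + 2) (by omega) (act_arr k (t := 3 * i + 1) (by omega)
        (act_arr k (t := 3 * i) (by omega) ih)) v

end Skip

end LoopChain

/-! ### From squarefree equations to arbitrary affine varieties. -/

section Main

variable {K : Type u} [Field K]

/-- The zero set of a family of squarefree polynomials is the variety of the mast of a loop chain,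
for a suitable ideal of relations. -/
theorem LoopChain.exists_pathVariety_eq {ι : Type} [Fintype ι] [Nonempty ι]
    (G : Set (Finset ι →₀ K)) :
    ∃ (N : ℕ) (σ : ι ≃ DetourVar (mast N)) (W : Set (DetourVar (mast N) → K)),
      pathVariety (relIdeal (mast N) W) (mast N) =
        {k | ∀ g ∈ G, (g.sum fun A c => c * ∏ s ∈ A, k (σ s)) = 0} := by
  classical
  obtain ⟨N, hN, ⟨φ⟩⟩ : ∃ N, 0 < N ∧ Nonempty (ι ≃ Fin N) :=
    ⟨_, Fintype.card_pos, ⟨Fintype.equivFin ι⟩⟩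
  have hbij : Function.Bijective fun s : ι => slot (φ s).2 := by
    refine ⟨fun s t h => φ.injective (Fin.ext (slot_injective h)), fun δ => ?_⟩
    obtain ⟨i, hi, rfl⟩ := exists_slot δ
    refine ⟨φ.symm ⟨i, hi⟩, ?_⟩
    simp only [Equiv.apply_symm_apply]
  let σ : ι ≃ DetourVar (mast N) := Equiv.ofBijective _ hbij
  have hσ : ∀ s, σ s = slot (φ s).2 := fun s => rfl
  let W : Set (DetourVar (mast N) → K) :=
    {k | ∀ g ∈ G, (g.sum fun A c => c * ∏ s ∈ A, k (σ s)) = 0}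
  -- `W` is the zero set itself, so only V_p ⊆ W remains; for this each equation is realized as a
  -- relation between paths skipping loops.
  refine ⟨N, σ, W, Set.Subset.antisymm (fun k hk => ?_) subset_pathVariety_relIdeal⟩
  let path (A : Finset ι) : Quiver.Path (vtx N 0) (vtx N (3 * N)) :=
    skip {i | ∃ s ∈ A, (φ s : ℕ) = i} N le_rfl
  have hprod : ∀ (k : DetourVar (mast N) → K) (A : Finset ι) (v),
      red (mast N) k (ofPath K (path A)) (vtx N (3 * N)) v =
        if v = seg le_rfl then ∏ s ∈ A, k (σ s) else 0 := by
    intro k A v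
    rw [red_ofPath, ← act_topComb, act_skip]
    refine if_congr Iff.rfl ?_ rfl
    rw [Finset.prod_range, ← φ.prod_comp, ← Finset.prod_subset (Finset.subset_univ A)]
    · refine Finset.prod_congr rfl fun s hs => ?_
      rw [dif_pos ⟨(φ s).2, s, hs, rfl⟩, hσ]
    · intro s _ hs
      refine dif_neg ?_
      rintro ⟨-, t, ht, hts⟩
      exact hs (φ.injective (Fin.ext hts) ▸ ht)
  let rel (g : Finset ι →₀ K) : PathAlgebra K (LoopChain N) := g.sum fun A c => c • ofPath K (path A)
  have hrel : ∀ (k : DetourVar (mast N) → K) (g : Finset ι →₀ K) (v),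
      red (mast N) k (rel g) (vtx N (3 * N)) v =
        if v = seg le_rfl then g.sum fun A c => c * ∏ s ∈ A, k (σ s) else 0 := by
    intro k g v
    simp only [rel, Finsupp.sum, map_sum, map_smul, Finset.sum_apply, Pi.smul_apply, hprod,
      smul_eq_mul]
    split_ifs with h
    · rfl
    · simp
  intro g hg
  have hmem : rel g ∈ relIdeal (mast N) W := by
    refine mem_relIdeal_of_isSource (fun c q => path_source q) ?_ ?_ fun k hk => ?_
    · refine Submodule.sum_mem _ fun A _ => Submodule.smul_mem _ _ (Submodule.subset_span
        ⟨_, _, _, ?_, rfl⟩)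
      -- The length is at least `2 * N`, and `0 < N` makes this at least 2.
      have := le_skip_length {i | ∃ s ∈ A, (φ s : ℕ) = i} N le_rfl
      change 2 ≤ (skip {i | ∃ s ∈ A, (φ s : ℕ) = i} N le_rfl).length
      omega
    · simp only [rel, Finsupp.sum, Finset.sum_mul, smul_mul_assoc]
      refine Finset.sum_congr rfl fun A _ => ?_
      rw [vertexIdem, ofPath_mul_ofPath_same, Quiver.Path.nil_comp]
    · funext y v
      by_cases hy : y = vtx N (3 * N)
      · subst hy
        rw [hrel, hk g hg, ite_self]
        rfl
      · simp only [rel, Finsupp.sum, map_sum, map_smul, Finset.sum_apply, Pi.smul_apply]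
        refine Finset.sum_eq_zero fun A _ => ?_
        rw [red, LinearMap.flip_apply, rep_ofPath_ne _ _ _ _ hy, Pi.zero_apply, smul_zero]
  have h := hrel k g (seg le_rfl)
  rw [(mem_pathVariety _ _).1 hk _ hmem, if_pos rfl] at h
  exact h.symm

/-- The squarefree form of a monomial: for each `i`, as many copies of the `i`-th variable as the
exponent says. -/
def squarefreePart {n : ℕ} (d : ℕ) (m : Fin n →₀ ℕ) : Finset (Option (Fin n × Fin d)) :=
  (Finset.univ.filter fun s : Fin n × Fin d => s.2.1 < m s.1).map Function.Embedding.some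

theorem prod_squarefreePart {n d : ℕ} {m : Fin n →₀ ℕ} (hm : ∀ i, m i ≤ d)
    {κ : Option (Fin n × Fin d) → K} {x : Fin n → K} (hκ : ∀ i j, κ (some (i, j)) = x i) :
    ∏ s ∈ squarefreePart d m, κ s = ∏ i, x i ^ m i := by
  rw [squarefreePart, Finset.prod_map, Finset.prod_filter, Fintype.prod_prod_type]
  refine Finset.prod_congr rfl fun i _ => ?_
  simp only [Function.Embedding.some_apply, hκ]
  rw [← Finset.prod_filter, Finset.prod_const]
  congr 1
  rw [Fin.card_filter_val_lt, min_eq_right (hm i)]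

/-- The squarefree form of a polynomial. -/
noncomputable def squarefreeForm {n : ℕ} (d : ℕ) (f : MvPolynomial (Fin n) K) :
    Finset (Option (Fin n × Fin d)) →₀ K :=
  ∑ m ∈ f.support, Finsupp.single (squarefreePart d m) (f.coeff m)

theorem sum_squarefreeForm {n d : ℕ} {f : MvPolynomial (Fin n) K}
    (hf : ∀ m ∈ f.support, ∀ i, m i ≤ d)
    {κ : Option (Fin n × Fin d) → K} {x : Fin n → K} (hκ : ∀ i j, κ (some (i, j)) = x i) :
    ((squarefreeForm d f).sum fun A c => c * ∏ s ∈ A, κ s) = MvPolynomial.eval x f := by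
  classical
  rw [squarefreeForm, ← Finsupp.sum_finsetSum_index (by simp) (by simp [add_mul]),
    MvPolynomial.eval_eq']
  refine Finset.sum_congr rfl fun m hm => ?_
  rw [Finsupp.sum_single_index (by simp), prod_squarefreePart (hf m hm) hκ]

/-- Hilbert's basis theorem; finiteness gives a common bound on exponents, hence on the number of
copies needed. -/
theorem IsAffineVariety.exists_finset {n : ℕ} {V : Set (Fin n → K)} (hV : IsAffineVariety V) :
    ∃ F : Finset (MvPolynomial (Fin n) K), V = {x | ∀ f ∈ F, MvPolynomial.eval x f = 0} := by
  obtain ⟨F, rfl⟩ := hV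
  obtain ⟨F', hF', h⟩ := (Submodule.fg_span_iff_fg_span_finset_subset F).1
    (IsNoetherian.noetherian (Submodule.span (MvPolynomial (Fin n) K) F))
  refine ⟨F', Set.Subset.antisymm (fun x hx f hf => hx f (hF' hf)) fun x hx f hf => ?_⟩
  have hle : Submodule.span (MvPolynomial (Fin n) K) F ≤
      RingHom.ker (MvPolynomial.eval x) := by
    rw [h]
    exact Submodule.span_le.2 fun g hg => hx g hg
  exact hle (Submodule.subset_span hf)

theorem LoopChain.exists_varietyIso {n : ℕ} {V : Set (Fin n → K)} (hV : IsAffineVariety V) :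
    ∃ (N : ℕ) (W : Set (DetourVar (mast N) → K)),
      VarietyIso (pathVariety (relIdeal (mast N) W) (mast N)) V := by
  obtain ⟨F, rfl⟩ := hV.exists_finset
  -- With `d + 1` copies, copy 0 of each coordinate exists even if all exponents vanish.
  obtain ⟨d, hd⟩ : ∃ d : ℕ, ∀ f ∈ F, ∀ m ∈ f.support, ∀ i, m i ≤ d + 1 := by
    refine ⟨F.sup MvPolynomial.totalDegree, fun f hf m hm i => ?_⟩
    have h₁ : m i ≤ f.degreeOf i := MvPolynomial.monomial_le_degreeOf i hm
    have h₂ := MvPolynomial.degreeOf_le_totalDegree f i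
    have h₃ := Finset.le_sup (f := MvPolynomial.totalDegree) hf
    omega
  -- The extra variable `none`, set to zero, keeps the index type nonempty when `n = 0`. The linear
  -- equations equate all copies with copy 0; the rest are the equations of the variety, made
  -- squarefree.
  let G : Set (Finset (Option (Fin n × Fin (d + 1))) →₀ K) :=
    {Finsupp.single {none} 1} ∪
      (Set.range fun s : Fin n × Fin (d + 1) =>
        Finsupp.single {some s} 1 - Finsupp.single {some (s.1, 0)} 1) ∪
      squarefreeForm (d + 1) '' F
  have hG : ∀ κ : Option (Fin n × Fin (d + 1)) → K,
      (∀ g ∈ G, (g.sum fun A c => c * ∏ s ∈ A, κ s) = 0) ↔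
        κ none = 0 ∧ (∀ i j, κ (some (i, j)) = κ (some (i, 0))) ∧
          ∀ f ∈ F, MvPolynomial.eval (fun i => κ (some (i, 0))) f = 0 := by
    intro κ
    have h₁ : ∀ s : Option (Fin n × Fin (d + 1)),
        ((Finsupp.single {s} (1 : K)).sum fun A c => c * ∏ s ∈ A, κ s) = κ s := fun s => by
      rw [Finsupp.sum_single_index (by simp), Finset.prod_singleton, one_mul]
    have h₂ : ∀ s t : Option (Fin n × Fin (d + 1)),
        ((Finsupp.single {s} (1 : K) - Finsupp.single {t} 1).sum fun A c => c * ∏ s ∈ A, κ s) =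
          κ s - κ t := fun s t => by
      rw [Finsupp.sum_sub_index (by intro A c c'; rw [sub_mul]), h₁, h₁]
    constructor
    · intro h
      have hc : ∀ i j, κ (some (i, j)) = κ (some (i, 0)) := fun i j => by
        have := h _ (Or.inl (Or.inr ⟨(i, j), rfl⟩))
        rw [h₂] at this
        exact sub_eq_zero.1 this
      refine ⟨?_, hc, fun f hf => ?_⟩
      · have := h _ (Or.inl (Or.inl rfl))
        rwa [h₁] at this
      · have := h _ (Or.inr ⟨f, hf, rfl⟩)
        rwa [sum_squarefreeForm (hd f hf) hc] at this
    · rintro ⟨h0, hc, hf⟩ g ((rfl | ⟨s, rfl⟩) | ⟨f, hfF, rfl⟩)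
      · rw [h₁, h0]
      · rw [h₂, hc, sub_self]
      · rw [sum_squarefreeForm (hd f hfF) hc, hf f hfF]
  obtain ⟨N, σ, W, hW⟩ := LoopChain.exists_pathVariety_eq G
  have hmem : ∀ k : DetourVar (mast N) → K, k ∈ pathVariety (relIdeal (mast N) W) (mast N) ↔
      k (σ none) = 0 ∧ (∀ i j, k (σ (some (i, j))) = k (σ (some (i, 0)))) ∧
          ∀ f ∈ F, MvPolynomial.eval (fun i => k (σ (some (i, 0)))) f = 0 := fun k => by
    rw [hW]
    exact hG fun s => k (σ s)
  refine ⟨N, W, fun i => MvPolynomial.X (σ (some (i, 0))),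
    fun δ => (σ.symm δ).elim 0 fun s => MvPolynomial.X s.1, fun k hk => ?_, fun x hx => ?_,
    fun k hk => ?_, fun x _ => ?_⟩
  · simp only [MvPolynomial.eval_X]
    exact ((hmem k).1 hk).2.2
  · rw [hmem]
    simpa using hx
  · obtain ⟨h0, hc, -⟩ := (hmem k).1 hk
    funext δ
    obtain ⟨s, rfl⟩ := σ.surjective δ
    rcases s with - | ⟨i, j⟩
    · simp [h0]
    · simp [hc i j]
  · simp

end Main

end Uniserial

theorem proposition3p7 {K : Type u} [Field K] [Infinite K] (n : ℕ) (V : Set (Fin n → K))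
    (hV : Uniserial.IsAffineVariety V) :
    ∃ (Γ : Type) (_ : Quiver.{0} Γ) (_ : Fintype Γ) (_ : ∀ x y : Γ, Finite (x ⟶ y))
      (I : Ideal (Uniserial.PathAlgebra K Γ)) (_ : I.IsTwoSided),
      Uniserial.IsAdmissible I ∧ Uniserial.ConditionN I ∧
      (∀ x y : Γ, Subsingleton (x ⟶ y)) ∧
      ∃ (l : ℕ) (S : Fin (l + 1) → ModuleCat.{u} (Uniserial.PathAlgebra K Γ ⧸ I))
        (e : Fin (l + 1) → Γ) (p : Quiver.Path (e 0) (e (Fin.last l))),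
        (∀ i, Uniserial.IsSimpleAt I (e i) (S i)) ∧
        p.vertices = List.ofFn e ∧
        Uniserial.VarietyIso (Uniserial.pathVariety I p) V ∧
        Set.BijOn (Uniserial.Phi I p) (Uniserial.pathVariety I p)
          (Uniserial.uniserialTypes (Uniserial.PathAlgebra K Γ ⧸ I) S) := by
  obtain ⟨N, W, hiso⟩ := Uniserial.LoopChain.exists_varietyIso hV
  refine ⟨Uniserial.LoopChain N, inferInstance, inferInstance, inferInstance, Uniserial.relIdeal (Uniserial.LoopChain.mast N) W,
    inferInstance, Uniserial.isAdmissible_relIdeal, Uniserial.LoopChain.conditionN _, inferInstance, 3 * N,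
    fun i => Uniserial.simpleAt _ (Uniserial.LoopChain.vtx N i), fun i => Uniserial.LoopChain.vtx N i, Uniserial.LoopChain.mast N,
    fun i => Uniserial.isSimpleAt_simpleAt Uniserial.isAdmissible_relIdeal _, Uniserial.LoopChain.walk_vertices _ _, hiso, ?_⟩
  refine Uniserial.Phi_bijOn (e := fun i : Fin (3 * N + 1) => Uniserial.LoopChain.vtx N i) (p := Uniserial.LoopChain.mast N) Uniserial.isAdmissible_relIdeal
    inferInstance (Uniserial.LoopChain.walk_vertices _ _) fun i hi => ?_
  -- The mast is at vertex 0 only at step 0, as `Phi_bijOn` requires.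
  have := congrArg Uniserial.LoopChain.val hi
  simp only [Fin.val_zero] at this
  rw [Uniserial.LoopChain.val_vtx (by omega), Uniserial.LoopChain.val_vtx (by omega)] at this
  exact Fin.ext (by simp only [Fin.val_zero]; omega)
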